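/- Let $\Gamma$ be a connected compact metric graph, i.e. a connected graph with finitely many vertices and edges (loops and multiple edges allowed) in which every edge $e$ has a finite length $\ell_e>0$ and is identified with the interval $[0,\ell_e]$. Let $V_D$ be a non-empty set of vertices, let $1<p<\infty$, and let $e_0$ be an edge. Write $\int_\Gamma u=\sum_e\int_0^{\ell_e}u_e\,dx$. Let $W^{1,p}(\Gamma)$ be the space of continuous functions $u$ on $\Gamma$ whose restriction $u_e$ to each edge belongs to $W^{1,p}(0,\ell_e)$, and let $\mathcal X(\Gamma,V_D)=\{u\in W^{1,p}(\Gamma): u=0 \text{ on } V_D\}$. The first eigenvalue of the $p$-Laplacian is $$\lambda_{1,p}(\Gamma,V_D)=\inf\left\{\frac{\int_\Gamma|u'|^p}{\int_\Gamma|u|^p}: u\in\mathcal X(\Gamma,V_D),\ u\neq0\right\}.$$ An eigenfunction associated to $\mu\in\mathbb R$ is a $u\in\mathcal X(\Gamma,V_D)$, $u\ne0$, such that $\int_\Gamma|u'|^{p-2}u'w'=\mu\int_\Gamma|u|^{p-2}uw$ for all $w\in\mathcal X(\Gamma,V_D)$. For $\delta>-\ell_{e_0}$ let $\Gamma_\delta$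 be the metric graph obtained from $\Gamma$ by changing the length of $e_0$ from $\ell_{e_0}$ to $\ell_{e_0}+\delta$ (all other lengths unchanged), and let $\lambda(\delta)=\lambda_{1,p}(\Gamma_\delta,V_D)$. Let $\mathcal E$ be the set of eigenfunctions $u$ of $\Gamma$ associated to $\lambda(0)$ with $\|u\|_{L^p(\Gamma)}=\left(\int_\Gamma|u|^p\right)^{1/p}=1$. Then $\lambda$ is right and left differentiable at $\delta=0$, the minimum and the maximum below are attained, and $$\lim_{\delta\to0^+}\frac{\lambda(\delta)-\lambda(0)}{\delta}=\min_{u\in\mathcal E}\left\{-\frac{p-1}{\ell_{e_0}}\int_0^{\ell_{e_0}}|u_{e_0}'|^p\,dx-\frac{\lambda(0)}{\ell_{e_0}}\int_0^{\ell_{e_0}}|u_{e_0}|^p\,dx\right\},$$ $$\lim_{\delta\to0^-}\frac{\lambda(\delta)-\lambda(0)}{\delta}=\max_{u\in\mathcal E}\left\{-\frac{p-1}{\ell_{e_0}}\int_0^{\ell_{e_0}}|u_{e_0}'|^p\,dx-\frac{\lambda(0)}{\ell_{e_0}}\int_0^{\ell_{e_0}}|u_{e_0}|^p\,dx\right\}.$$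 -/

import Mathlib

open Set Filter Topology MeasureTheory
open scoped ContDiff

noncomputable section

namespace QuantumGraph

/-- A graph with vertex type `V` and edge type `E`, each edge being given a direction.
Loops and multiple edges are allowed. -/
structure DirectedGraph (V E : Type*) where
  /-- the initial vertex of an edge -/
  src : E → V
  /-- the terminal vertex of an edge -/
  tgt : E → V

variable {V E : Type*}

/-- Two vertices are adjacent if some edge connects them, in either direction. -/
def DirectedGraph.Adjacent (Γ : DirectedGraph V E) (v w : V) : Prop :=
  ∃ e, (Γ.src e = v ∧ Γ.tgt e = w) ∨ (Γ.src e = w ∧ Γ.tgt e = v)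

/-- Any two vertices are joined by a walk. -/
def DirectedGraph.Connected (Γ : DirectedGraph V E) : Prop :=
  Nonempty V ∧ ∀ v w, Relation.ReflTransGen Γ.Adjacent v w

/-- `g` is the weak derivative of `u` on the interval `(a, b)`. -/
def HasWeakDerivOn (a b : ℝ) (u g : ℝ → ℝ) : Prop :=
  ∀ φ : ℝ → ℝ, ContDiff ℝ ∞ φ → HasCompactSupport φ → tsupport φ ⊆ Ioo a b →
    ∫ x in a..b, u x * deriv φ x = - ∫ x in a..b, g x * φ x

/-- The elements `u` of `W^{1,p}` of the metric graph in which the edge `e` of `Γ` has length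
`ℓ e` and is identified with `[0, ℓ e]`, from its initial to its terminal vertex. Such a `u` is a
continuous function on the metric graph: it has a value at every vertex, and on every edge it is
continuous on `[0, ℓ e]` with the values of the two end vertices at `0` and `ℓ e`. (Hence it is in
`L^p`.) It is listed together with its weak derivative, which it determines almost everywhere, and
which is in `L^p` of every edge. The values of `toFun e` and `der e` outside `[0, ℓ e]` play no
role. -/
structure W1p (Γ : DirectedGraph V E) (ℓ : E → ℝ) (p : ℝ) where
  /-- the values at the vertices -/
  vertexVal : V → ℝ
  /-- the restrictions `u_e` to the edges -/
  toFun : E → ℝ → ℝ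
  /-- the weak derivatives `u_e'` -/
  der : E → ℝ → ℝ
  continuousOn : ∀ e, ContinuousOn (toFun e) (Icc 0 (ℓ e))
  val_src : ∀ e, toFun e 0 = vertexVal (Γ.src e)
  val_tgt : ∀ e, toFun e (ℓ e) = vertexVal (Γ.tgt e)
  memLp_der : ∀ e, MemLp (der e) (ENNReal.ofReal p) (volume.restrict (Ioo 0 (ℓ e)))
  hasWeakDeriv : ∀ e, HasWeakDerivOn 0 (ℓ e) (toFun e) (der e)

/-- The integral over the metric graph: the sum of the integrals over the edges. -/
def graphIntegral [Fintype E] (ℓ : E → ℝ) (f : E → ℝ → ℝ) : ℝ :=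
  ∑ e, ∫ x in (0 : ℝ)..(ℓ e), f e x

/-- The space of the functions in `W^{1,p}` that vanish at the vertices in `VD`. -/
def dirichletSpace (Γ : DirectedGraph V E) (ℓ : E → ℝ) (p : ℝ) (VD : Set V) :
    Set (W1p Γ ℓ p) :=
  {u | ∀ v ∈ VD, u.vertexVal v = 0}

/-- `u` is not the zero function on the metric graph. -/
def W1p.Nontrivial {Γ : DirectedGraph V E} {ℓ : E → ℝ} {p : ℝ} (u : W1p Γ ℓ p) : Prop :=
  ∃ e, ∃ x ∈ Icc 0 (ℓ e), u.toFun e x ≠ 0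

/-- The `L^p` norm of `u` on the metric graph. -/
def W1p.lpNorm [Fintype E] {Γ : DirectedGraph V E} {ℓ : E → ℝ} {p : ℝ} (u : W1p Γ ℓ p) : ℝ :=
  (graphIntegral ℓ fun e x => |u.toFun e x| ^ p) ^ (1 / p)

/-- The first eigenvalue `λ_{1,p}`: the infimum of the Rayleigh quotient. -/
def firstEigenvalue [Fintype E] (Γ : DirectedGraph V E) (ℓ : E → ℝ) (p : ℝ) (VD : Set V) : ℝ :=
  sInf {r | ∃ u ∈ dirichletSpace Γ ℓ p VD, u.Nontrivial ∧
    r = (graphIntegral ℓ fun e x => |u.der e x| ^ p) /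
      (graphIntegral ℓ fun e x => |u.toFun e x| ^ p)}

/-- `u` is an eigenfunction of the `p`-Laplacian associated to `μ`, in the weak sense. -/
def IsEigenfunction [Fintype E] (Γ : DirectedGraph V E) (ℓ : E → ℝ) (p : ℝ) (VD : Set V)
    (μ : ℝ) (u : W1p Γ ℓ p) : Prop :=
  u ∈ dirichletSpace Γ ℓ p VD ∧ u.Nontrivial ∧
    ∀ w ∈ dirichletSpace Γ ℓ p VD,
      (graphIntegral ℓ fun e x => |u.der e x| ^ (p - 2) * u.der e x * w.der e x) =
        μ * graphIntegral ℓ fun e x => |u.toFun e x| ^ (p - 2) * u.toFun e x * w.toFun e x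

/-- The eigenfunctions associated to the first eigenvalue, normalized in `L^p`. -/
def normalizedFirstEigenfunctions [Fintype E] (Γ : DirectedGraph V E) (ℓ : E → ℝ) (p : ℝ)
    (VD : Set V) : Set (W1p Γ ℓ p) :=
  {u | IsEigenfunction Γ ℓ p VD (firstEigenvalue Γ ℓ p VD) u ∧ u.lpNorm = 1}

/-- The edge lengths after the length of `e₀` has been changed by `δ`. (They are all positive for
`δ` greater than minus the length of `e₀`, hence for all `δ` near `0`.) -/
def perturbedLength [DecidableEq E] (ℓ : E → ℝ) (e₀ : E) (δ : ℝ) : E → ℝ :=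
  fun e => if e = e₀ then ℓ e₀ + δ else ℓ e

/-- The function `δ ↦ λ(δ)`. -/
def perturbedEigenvalue [Fintype E] [DecidableEq E] (Γ : DirectedGraph V E) (ℓ : E → ℝ) (p : ℝ)
    (VD : Set V) (e₀ : E) (δ : ℝ) : ℝ :=
  firstEigenvalue Γ (perturbedLength ℓ e₀ δ) p VD

/-- `-((p-1)/ℓ_{e₀}) ∫_{e₀} |u'|^p - (λ(0)/ℓ_{e₀}) ∫_{e₀} |u|^p`, where `λ(0)` is the first
eigenvalue of the unperturbed graph. -/
def shapeFunctional [Fintype E] (Γ : DirectedGraph V E) (ℓ : E → ℝ) (p : ℝ)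
    (VD : Set V) (e₀ : E) (u : W1p Γ ℓ p) : ℝ :=
  -((p - 1) / ℓ e₀) * (∫ x in (0 : ℝ)..(ℓ e₀), |u.der e₀ x| ^ p) -
    (firstEigenvalue Γ ℓ p VD / ℓ e₀) * ∫ x in (0 : ℝ)..(ℓ e₀), |u.toFun e₀ x| ^ p

end QuantumGraph

end

/-! Stretching `e₀` affinely by the factor t = (ℓ e₀ + δ) / ℓ e₀ pulls every function of the
perturbed graph back to the fixed graph. This multiplies the mass on `e₀` by t and the energy there
by t ^ (1 - p). Hence λ(δ) is the infimum, over u of mass 1 on the fixed graph, of (energy u + (t ^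
(1 - p) - 1) a(u)) / (1 + (t - 1) b(u)), where a and b are the energy and the mass on `e₀`
(`isGLB_perturbedEigenvalue`).

The derivative of such an infimum is an envelope formula: to first order only the minimizers at δ =
0 count, and the right derivative is the least derivative of the quotient among them
(`tendsto_envelope`). Each minimizer contributes ((1 - p) a(u) - λ(0) b(u)) / ℓ e₀, which is the
shape functional. The left derivative follows by applying the same result to δ = -θ.

The envelope formula needs a and b to converge along a subsequence of every normalized minimizing
sequence (`exists_minimizer_of_tendsto`). Arzelà–Ascoli makes the functions converge uniformly,
which settles the masses. Midpoints of far terms then have mass near 1, hence energy not much below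
λ(0), and uniform convexity of |x| ^ p (`exists_abs_sub_rpow_le`) forces the derivatives to be
Cauchy in L^p. Finally, normalized minimizers and normalized first eigenfunctions coincide
(`mem_normalizedFirstEigenfunctions_iff`). -/

/-! ### Envelope formula -/

/-- One-sided derivative of an infimum of quotients `(N + α a) / (1 + β b)` (envelope formula). -/
theorem tendsto_envelope {X : Type*} [Nonempty X] {N a b : X → ℝ} {lam : ℝ}
    (ha : ∀ u, 0 ≤ a u) (haN : ∀ u, a u ≤ N u) (hb : ∀ u, 0 ≤ b u) (hb1 : ∀ u, b u ≤ 1)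
    (hlam : IsGLB (range N) lam)
    (hcomp : ∀ u : ℕ → X, Tendsto (fun n => N (u n)) atTop (𝓝 lam) →
      ∃ v, N v = lam ∧ ∃ φ : ℕ → ℕ, StrictMono φ ∧
        Tendsto (fun n => a (u (φ n))) atTop (𝓝 (a v)) ∧
        Tendsto (fun n => b (u (φ n))) atTop (𝓝 (b v)))
    {α β Λ : ℝ → ℝ} {α' β' : ℝ}
    (hα : Tendsto (fun θ => α θ / θ) (𝓝[>] 0) (𝓝 α'))
    (hβ : Tendsto (fun θ => β θ / θ) (𝓝[>] 0) (𝓝 β'))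
    (hΛ : ∀ᶠ θ in 𝓝[>] 0, IsGLB (range fun u => (N u + α θ * a u) / (1 + β θ * b u)) (Λ θ)) :
    ∃ m, IsLeast ((fun u => α' * a u - lam * β' * b u) '' {u | N u = lam}) m ∧
      Tendsto (fun θ => (Λ θ - lam) / θ) (𝓝[>] 0) (𝓝 m) := by
  have hid : Tendsto (fun θ : ℝ => θ) (𝓝[>] 0) (𝓝 0) := tendsto_nhdsWithin_of_tendsto_nhds tendsto_id
  have hpos : ∀ᶠ θ : ℝ in 𝓝[>] 0, 0 < θ := eventually_mem_nhdsWithin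
  have hlam0 : 0 ≤ lam := hlam.2 (by rintro _ ⟨u, rfl⟩; exact (ha u).trans (haN u))
  have hNlam : ∀ u, lam ≤ N u := fun u => hlam.1 ⟨u, rfl⟩
  have key : ∀ {f : ℝ → ℝ} {f' : ℝ}, Tendsto (fun θ => f θ / θ) (𝓝[>] 0) (𝓝 f') →
      Tendsto f (𝓝[>] 0) (𝓝 0) := by
    intro f f' hf
    have := hf.mul hid
    rw [mul_zero] at this
    refine this.congr' ?_
    filter_upwards [hpos] with θ hθ
    field_simp
  have hα0 := key hα
  have hβ0 := key hβ
  set F : X → ℝ := fun u => α' * a u - lam * β' * b u with hF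
  obtain ⟨w, -, -, hwlim, hw⟩ := hlam.exists_seq_antitone_tendsto (range_nonempty N)
  choose w' hw' using hw
  obtain ⟨v₀, hv₀, -⟩ := hcomp w' (by simpa only [hw'] using hwlim)
  have hFbdd : BddBelow (F '' {u | N u = lam}) := by
    refine ⟨-(|α'| * lam) - lam * |β'|, ?_⟩
    rintro _ ⟨u, hu, rfl⟩
    have h1 : |α' * a u| ≤ |α'| * lam := by
      rw [abs_mul, abs_of_nonneg (ha u)]
      exact mul_le_mul_of_nonneg_left ((haN u).trans_eq hu) (abs_nonneg _)
    have h2 : |lam * β' * b u| ≤ lam * |β'| := by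
      rw [abs_mul, abs_mul, abs_of_nonneg (hb u), abs_of_nonneg hlam0]
      exact mul_le_of_le_one_right (by positivity) (hb1 u)
    have h3 := neg_abs_le (α' * a u)
    have h4 := le_abs_self (lam * β' * b u)
    simp only [hF]; linarith
  -- Direct method: a sequence of minimizers of `N` is itself minimizing for `N`, so the compactness
  -- hypothesis also shows that `F` attains its infimum over these minimizers.
  obtain ⟨y, -, hylim, hy⟩ := exists_seq_tendsto_sInf (S := F '' {u | N u = lam})
    ⟨_, v₀, hv₀, rfl⟩ hFbdd
  choose y' hy'N hy' using hy
  obtain ⟨v, hv, φ, hφ, hφa, hφb⟩ := hcomp y' (by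
    simp only [mem_ofPred_eq] at hy'N
    simp only [hy'N]; exact tendsto_const_nhds)
  have hFv : F v = sInf (F '' {u | N u = lam}) := by
    refine tendsto_nhds_unique ?_ (hylim.comp hφ.tendsto_atTop)
    have : Tendsto (fun n => F (y' (φ n))) atTop (𝓝 (F v)) :=
      (hφa.const_mul α').sub (hφb.const_mul (lam * β'))
    simpa only [hy', Function.comp_def] using this
  have hleast : IsLeast (F '' {u | N u = lam}) (F v) := by
    refine ⟨⟨v, hv, rfl⟩, ?_⟩
    rw [hFv]
    exact fun z hz => csInf_le hFbdd hz
  refine ⟨F v, hleast, ?_⟩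
  have hαs : ∀ᶠ θ in 𝓝[>] 0, |α θ| < 1 / 2 := by
    have := hα0.abs; rw [abs_zero] at this
    exact this.eventually_lt_const (by norm_num)
  have hβs : ∀ᶠ θ in 𝓝[>] 0, |β θ| < 1 / 2 := by
    have := hβ0.abs; rw [abs_zero] at this
    exact this.eventually_lt_const (by norm_num)
  have hden : ∀ θ u, |β θ| < 1 / 2 → 0 < 1 + β θ * b u := by
    intro θ u h
    have : |β θ * b u| ≤ 1 / 2 := by
      rw [abs_mul, abs_of_nonneg (hb u)]
      nlinarith [abs_nonneg (β θ), hb u, hb1 u]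
    linarith [neg_abs_le (β θ * b u)]
  -- The bound drops the nonnegative term (N u - lam) / θ; at a minimizer of `N` it is an equality.
  have hquot : ∀ θ u, 0 < θ → |β θ| < 1 / 2 →
      (α θ / θ * a u - lam * (β θ / θ) * b u) / (1 + β θ * b u) ≤
        ((N u + α θ * a u) / (1 + β θ * b u) - lam) / θ := by
    intro θ u hθ hβθ
    have hd := hden θ u hβθ
    have h1 : ((N u + α θ * a u) / (1 + β θ * b u) - lam) / θ =
      ((N u - lam) / θ + (α θ / θ * a u - lam * (β θ / θ) * b u)) / (1 + β θ * b u) := by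
      field_simp; ring
    rw [h1]
    gcongr
    have : 0 ≤ (N u - lam) / θ := div_nonneg (sub_nonneg.2 (hNlam u)) hθ.le
    linarith
  refine tendsto_order.2 ⟨fun c hc => ?_, fun c hc => ?_⟩
  · by_contra hcon
    have hfr := ((((not_eventually.1 hcon).and_eventually hΛ).and_eventually hpos).and_eventually
      hαs).and_eventually hβs
    obtain ⟨θ, hθ, hθp⟩ := exists_seq_forall_of_frequently hfr
    simp only [not_lt] at hθp
    have hθ0 : Tendsto θ atTop (𝓝 0) := hid.comp hθ
    -- The slack θ ^ 2 is o(θ), so near-minimizers chosen this closely cost nothing in the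
    -- difference quotient.
    have hex : ∀ n, ∃ u, (N u + α (θ n) * a u) / (1 + β (θ n) * b u) < Λ (θ n) + θ n ^ 2 := by
      intro n
      obtain ⟨⟨⟨⟨-, h1⟩, h2⟩, -⟩, -⟩ := hθp n
      obtain ⟨_, ⟨u, rfl⟩, -, hu⟩ := h1.exists_between (b := Λ (θ n) + θ n ^ 2)
        (by have := pow_pos h2 2; linarith)
      exact ⟨u, hu⟩
    choose u hu using hex
    have hΛub : ∀ n, Λ (θ n) ≤ lam + c * θ n := by
      intro n
      obtain ⟨⟨⟨⟨h0, -⟩, h2⟩, -⟩, -⟩ := hθp n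
      rw [div_le_iff₀ h2] at h0
      linarith
    -- Near-minimizers of the perturbed quotients are minimizing for `N`: since 0 ≤ a ≤ N, the
    -- numerator is at least N (1 - |α|), while the denominator is at most 1 + |β|.
    have hNu : Tendsto (fun n => N (u n)) atTop (𝓝 lam) := by
      have hup : Tendsto (fun n => (lam + c * θ n + θ n ^ 2) * (1 + |β (θ n)|) / (1 - |α (θ n)|))
          atTop (𝓝 lam) := by
        have h1 := ((hθ0.const_mul c).const_add lam).add (hθ0.pow 2)
        have h2 := ((hβ0.comp hθ).abs).const_add 1
        have h3 := ((hα0.comp hθ).abs).const_sub 1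
        simpa [Pi.div_def] using (h1.mul h2).div h3 (by simp)
      refine tendsto_of_tendsto_of_tendsto_of_le_of_le tendsto_const_nhds hup
        (fun n => hNlam _) (fun n => ?_)
      obtain ⟨⟨⟨⟨h0, -⟩, h2⟩, h3⟩, h4⟩ := hθp n
      have hd := hden _ (u n) h4
      have h5 := (div_lt_iff₀ hd).1 ((hu n).trans_le (add_le_add_left (hΛub n) _))
      have h6 : N (u n) * (1 - |α (θ n)|) ≤ N (u n) + α (θ n) * a (u n) := by
        have : |α (θ n) * a (u n)| ≤ N (u n) * |α (θ n)| := by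
          rw [abs_mul, abs_of_nonneg (ha _), mul_comm]
          exact mul_le_mul_of_nonneg_right (haN _) (abs_nonneg _)
        linarith [neg_abs_le (α (θ n) * a (u n))]
      have h7 : 1 + β (θ n) * b (u n) ≤ 1 + |β (θ n)| := by
        have : |β (θ n) * b (u n)| ≤ |β (θ n)| := by
          rw [abs_mul, abs_of_nonneg (hb _)]
          exact mul_le_of_le_one_right (abs_nonneg _) (hb1 _)
        linarith [le_abs_self (β (θ n) * b (u n))]
      rw [le_div_iff₀ (by linarith)]
      have h8 : 0 ≤ lam + c * θ n + θ n ^ 2 := by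
        by_contra hneg
        have := mul_neg_of_neg_of_pos (not_le.1 hneg) hd
        have h9 : 0 ≤ N (u n) * (1 - |α (θ n)|) :=
          mul_nonneg (hlam0.trans (hNlam _)) (by linarith)
        linarith
      exact h6.trans (h5.le.trans (mul_le_mul_of_nonneg_left h7 h8))
    obtain ⟨v', hv', ψ, hψ, hψa, hψb⟩ := hcomp u hNu
    have hθψ := hθ.comp hψ.tendsto_atTop
    have hlim : Tendsto (fun n => (α (θ (ψ n)) / θ (ψ n) * a (u (ψ n)) -
        lam * (β (θ (ψ n)) / θ (ψ n)) * b (u (ψ n))) / (1 + β (θ (ψ n)) * b (u (ψ n))))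
        atTop (𝓝 (F v')) := by
      have h1 := ((hα.comp hθψ).mul hψa).sub (((hβ.comp hθψ).const_mul lam).mul hψb)
      have h2 := ((hβ0.comp hθψ).mul hψb).const_add 1
      simpa [Pi.div_def, hF] using h1.div h2 (by simp)
    have hle : F v' ≤ c := by
      have h9 : Tendsto (fun n => c + θ (ψ n)) atTop (𝓝 c) := by
        simpa using (hθ0.comp hψ.tendsto_atTop).const_add c
      refine le_of_tendsto_of_tendsto' hlim h9 fun n => ?_
      obtain ⟨⟨⟨⟨h0, -⟩, h2⟩, h3⟩, h4⟩ := hθp (ψ n)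
      refine (hquot _ _ h2 h4).trans ?_
      rw [div_le_iff₀ h2]
      nlinarith [hu (ψ n), hΛub (ψ n)]
    exact absurd (hleast.2 ⟨v', hv', rfl⟩) (by simp only [not_le]; linarith)
  -- For the upper bound it suffices to test the infimum with the single minimizer `v`.
  · have hlim : Tendsto (fun θ => (α θ / θ * a v - lam * (β θ / θ) * b v) / (1 + β θ * b v))
        (𝓝[>] 0) (𝓝 (F v)) := by
      have h1 := (hα.mul_const (a v)).sub ((hβ.const_mul lam).mul_const (b v))
      have h2 := (hβ0.mul_const (b v)).const_add 1
      simpa [Pi.div_def, hF] using h1.div h2 (by simp)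
    filter_upwards [hlim.eventually_lt_const hc, hΛ, hpos, hβs] with θ h1 h2 h3 h4
    refine lt_of_le_of_lt ?_ h1
    have hd := hden θ v h4
    have h5 : Λ θ ≤ (N v + α θ * a v) / (1 + β θ * b v) := h2.1 ⟨v, rfl⟩
    have h6 : (α θ / θ * a v - lam * (β θ / θ) * b v) / (1 + β θ * b v) =
        ((N v + α θ * a v) / (1 + β θ * b v) - lam) / θ := by
      rw [show N v = lam from hv]; field_simp; ring
    rw [h6]
    gcongr

/-! ### Uniform convexity of |x| ^ p and convergence in L^p -/

/-- If |a| ≠ |b|, strict convexity of t ^ p on [0, ∞) applies after the triangle inequality;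
otherwise a = -b ≠ 0 and the midpoint is 0. -/
theorem abs_midpoint_rpow_lt {p : ℝ} (hp : 1 < p) {a b : ℝ} (hab : a ≠ b) :
    |(a + b) / 2| ^ p < (|a| ^ p + |b| ^ p) / 2 := by
  have hp0 : 0 < p := by linarith
  have h1 : |(a + b) / 2| ≤ (1 / 2 : ℝ) * |a| + (1 / 2 : ℝ) * |b| := by
    rw [abs_div, abs_two]; linarith [abs_add_le a b]
  have h2 := Real.rpow_le_rpow (abs_nonneg _) h1 hp0.le
  rcases eq_or_ne |a| |b| with h | h
  · rcases abs_eq_abs.1 h with h3 | h3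
    · exact absurd h3 hab
    · have hb : b ≠ 0 := by rintro rfl; simp_all
      subst h3
      simp only [neg_add_cancel, zero_div, abs_zero, Real.zero_rpow hp0.ne', abs_neg]
      have := Real.rpow_pos_of_pos (abs_pos.2 hb) p
      linarith
  · have h3 := (strictConvexOn_rpow hp).2 (abs_nonneg a) (abs_nonneg b) h
      (by norm_num : (0 : ℝ) < 1 / 2) (by norm_num : (0 : ℝ) < 1 / 2) (by norm_num)
    simp only [smul_eq_mul] at h3
    linarith

theorem abs_midpoint_rpow_le {p : ℝ} (hp : 1 < p) (a b : ℝ) :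
    |(a + b) / 2| ^ p ≤ (|a| ^ p + |b| ^ p) / 2 := by
  rcases eq_or_ne a b with rfl | h
  · simp
  · exact (abs_midpoint_rpow_lt hp h).le

/-- A quantitative form of the strict convexity of `|x| ^ p`. -/
theorem exists_abs_sub_rpow_le {p : ℝ} (hp : 1 < p) {ε : ℝ} (hε : 0 < ε) :
    ∃ C : ℝ, 0 ≤ C ∧ ∀ a b : ℝ, |a - b| ^ p ≤
      ε * (|a| ^ p + |b| ^ p) + C * ((|a| ^ p + |b| ^ p) / 2 - |(a + b) / 2| ^ p) := by
  have hp0 : 0 < p := by linarith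
  have hc : ∀ {f : ℝ × ℝ → ℝ}, Continuous f → Continuous fun x => |f x| ^ p := fun hf =>
    hf.abs.rpow_const fun _ => Or.inr hp0.le
  have hc1 : Continuous fun x : ℝ × ℝ => |x.1| ^ p + |x.2| ^ p :=
    (hc continuous_fst).add (hc continuous_snd)
  have hc2 : Continuous fun x : ℝ × ℝ => |x.1 - x.2| ^ p := hc (continuous_fst.sub continuous_snd)
  have hc3 : Continuous fun x : ℝ × ℝ => (|x.1| ^ p + |x.2| ^ p) / 2 - |(x.1 + x.2) / 2| ^ p :=
    (hc1.div_const 2).sub (hc ((continuous_fst.add continuous_snd).div_const 2))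
  -- `K` is the part of the unit sphere where the ε-term alone may not suffice. It avoids the
  -- diagonal, so by compactness the convexity gap has a lower bound d > 0 there. In the sup norm
  -- |x.1 - x.2| ≤ 2, whence the constant 2 ^ p / d.
  set K : Set (ℝ × ℝ) := Metric.sphere 0 1 ∩
    {x | ε * (|x.1| ^ p + |x.2| ^ p) ≤ |x.1 - x.2| ^ p} with hKdef
  have hK : IsCompact K := (isCompact_sphere _ _).inter_right
    (isClosed_le (hc1.const_mul ε) hc2)
  have hs : ∀ x : ℝ × ℝ, ‖x‖ = 1 → 0 < |x.1| ^ p + |x.2| ^ p := by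
    intro x hx
    have h0 := Real.rpow_nonneg (abs_nonneg x.1) p
    have h1 := Real.rpow_nonneg (abs_nonneg x.2) p
    rw [Prod.norm_def, Real.norm_eq_abs, Real.norm_eq_abs] at hx
    rcases max_choice |x.1| |x.2| with h | h <;> rw [h] at hx <;> simp only [hx, Real.one_rpow] at * <;>
      linarith
  obtain ⟨d, hd, hdK⟩ := hK.exists_forall_le' (a := (0 : ℝ)) hc3.continuousOn (by
    rintro x ⟨hx, hx'⟩
    have hx1 : ‖x‖ = 1 := by simpa using hx
    have hne : x.1 ≠ x.2 := by
      intro h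
      simp only [mem_ofPred_eq, h, sub_self, abs_zero, Real.zero_rpow hp0.ne'] at hx'
      have := mul_pos hε (hs x hx1)
      rw [h] at this
      linarith
    linarith [abs_midpoint_rpow_lt hp hne])
  have hunit : ∀ x : ℝ × ℝ, ‖x‖ = 1 → |x.1 - x.2| ^ p ≤
      ε * (|x.1| ^ p + |x.2| ^ p) + 2 ^ p / d *
        ((|x.1| ^ p + |x.2| ^ p) / 2 - |(x.1 + x.2) / 2| ^ p) := by
    intro x hx
    by_cases h : ε * (|x.1| ^ p + |x.2| ^ p) ≤ |x.1 - x.2| ^ p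
    · have h1 := hdK x ⟨by simpa using hx, h⟩
      have h2 : |x.1 - x.2| ^ p ≤ 2 ^ p := by
        refine Real.rpow_le_rpow (abs_nonneg _) ?_ hp0.le
        have h3 := norm_fst_le x
        have h4 := norm_snd_le x
        rw [hx, Real.norm_eq_abs] at h3 h4
        linarith [abs_sub x.1 x.2]
      have h3 : (2 : ℝ) ^ p ≤ 2 ^ p / d *
          ((|x.1| ^ p + |x.2| ^ p) / 2 - |(x.1 + x.2) / 2| ^ p) := by
        rw [div_mul_eq_mul_div, le_div_iff₀ hd]
        exact mul_le_mul_of_nonneg_left h1 (by positivity)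
      have := mul_pos hε (hs x hx)
      linarith
    · have : 0 ≤ 2 ^ p / d * ((|x.1| ^ p + |x.2| ^ p) / 2 - |(x.1 + x.2) / 2| ^ p) :=
        mul_nonneg (by positivity) (sub_nonneg.2 (abs_midpoint_rpow_le hp _ _))
      linarith
  refine ⟨2 ^ p / d, by positivity, fun a b => ?_⟩
  rcases eq_or_ne ((a, b) : ℝ × ℝ) 0 with h | h
  · obtain ⟨rfl, rfl⟩ := Prod.mk_eq_zero.1 h
    simp [Real.zero_rpow hp0.ne']
  -- Both sides are homogeneous of degree `p`, which reduces the claim to the unit sphere.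
  · set r := ‖((a, b) : ℝ × ℝ)‖ with hr
    have hr0 : 0 < r := norm_pos_iff.2 h
    have hscale : ∀ y : ℝ, |y| ^ p = r ^ p * |r⁻¹ * y| ^ p := by
      intro y
      rw [abs_mul, Real.mul_rpow (abs_nonneg _) (abs_nonneg _), abs_of_pos (inv_pos.2 hr0),
        Real.inv_rpow hr0.le, ← mul_assoc, mul_inv_cancel₀ (Real.rpow_pos_of_pos hr0 p).ne', one_mul]
    have h1 := hunit (r⁻¹ • (a, b)) (by
      rw [norm_smul, norm_inv, norm_norm, inv_mul_cancel₀ hr0.ne'])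
    simp only [Prod.smul_mk, smul_eq_mul] at h1
    rw [hscale (a - b), hscale ((a + b) / 2), hscale a, hscale b]
    have h2 := mul_le_mul_of_nonneg_left h1 (Real.rpow_nonneg hr0.le p)
    rw [← mul_sub, ← mul_add, mul_div_assoc] at h2
    nlinarith [h2]

section Lp

variable {α : Type*} [MeasurableSpace α] {μ : Measure α}

theorem MeasureTheory.MemLp.integrable_abs_rpow {p : ℝ} (hp : 1 < p) {f : α → ℝ}
    (hf : MemLp f (ENNReal.ofReal p) μ) : Integrable (fun x => |f x| ^ p) μ := by
  have h := hf.integrable_norm_rpow (by simp; linarith) ENNReal.ofReal_ne_top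
  rw [ENNReal.toReal_ofReal (by linarith)] at h
  simpa only [Real.norm_eq_abs] using h

/-- This is how uniform convexity is used: once the integrals for f, g and their midpoint approach a
common value, the `C`-term disappears and the arbitrarily small ε-term remains. -/
theorem integral_abs_sub_rpow_le {p : ℝ} (hp : 1 < p) {ε C : ℝ}
    (h : ∀ a b : ℝ, |a - b| ^ p ≤
      ε * (|a| ^ p + |b| ^ p) + C * ((|a| ^ p + |b| ^ p) / 2 - |(a + b) / 2| ^ p))
    {f g : α → ℝ} (hf : MemLp f (ENNReal.ofReal p) μ) (hg : MemLp g (ENNReal.ofReal p) μ) :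
    ∫ x, |f x - g x| ^ p ∂μ ≤ ε * ((∫ x, |f x| ^ p ∂μ) + ∫ x, |g x| ^ p ∂μ) +
      C * (((∫ x, |f x| ^ p ∂μ) + ∫ x, |g x| ^ p ∂μ) / 2 - ∫ x, |(f x + g x) / 2| ^ p ∂μ) := by
  have h1 := hf.integrable_abs_rpow hp
  have h2 := hg.integrable_abs_rpow hp
  have h3 : Integrable (fun x => |(f x + g x) / 2| ^ p) μ :=
    MemLp.integrable_abs_rpow hp (f := fun x => (f x + g x) / 2) (by
      simpa only [div_eq_inv_mul] using! (hf.add hg).const_mul (2⁻¹ : ℝ))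
  have h4 := (hf.sub hg).integrable_abs_rpow hp
  have h5 : Integrable (fun x => |f x| ^ p + |g x| ^ p) μ := h1.add h2
  have h6 : Integrable (fun x => (|f x| ^ p + |g x| ^ p) / 2 - |(f x + g x) / 2| ^ p) μ :=
    (h5.div_const 2).sub h3
  rw [← integral_add h1 h2, ← integral_const_mul, ← integral_div,
    ← integral_sub (h5.div_const 2) h3, ← integral_const_mul,
    ← integral_add (h5.const_mul ε) (h6.const_mul C)]
  exact integral_mono h4 ((h5.const_mul ε).add (h6.const_mul C)) fun x => h _ _

/-- A sequence in `L^p` that is Cauchy for `∫ |f - g| ^ p` converges. -/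
theorem exists_memLp_tendsto_integral_abs_sub_rpow {p : ℝ} (hp : 1 < p) {f : ℕ → α → ℝ}
    (hf : ∀ n, MemLp (f n) (ENNReal.ofReal p) μ)
    (hc : ∀ ε > 0, ∃ n₀, ∀ m ≥ n₀, ∀ n ≥ n₀, ∫ x, |f m x - f n x| ^ p ∂μ < ε) :
    ∃ g, MemLp g (ENNReal.ofReal p) μ ∧
      Tendsto (fun n => ∫ x, |f n x - g x| ^ p ∂μ) atTop (𝓝 0) ∧
      Tendsto (fun n => ∫ x, |f n x| ^ p ∂μ) atTop (𝓝 (∫ x, |g x| ^ p ∂μ)) := by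
  have hp0 : 0 < p := by linarith
  have : Fact (1 ≤ ENNReal.ofReal p) := ⟨by simpa using hp.le⟩
  have hnorm : ∀ h : Lp ℝ (ENNReal.ofReal p) μ, ∫ x, |h x| ^ p ∂μ = ‖h‖ ^ p := by
    intro h
    have h1 := (Lp.memLp h).eLpNorm_eq_integral_rpow_norm (by simpa using hp0) ENNReal.ofReal_ne_top
    rw [ENNReal.toReal_ofReal hp0.le] at h1
    have h0 : 0 ≤ ∫ x, ‖h x‖ ^ p ∂μ := integral_nonneg fun x => by positivity
    rw [Lp.norm_def, h1, ENNReal.toReal_ofReal (Real.rpow_nonneg h0 _), Real.rpow_inv_rpow h0 hp0.ne']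
    rfl
  set F : ℕ → Lp ℝ (ENNReal.ofReal p) μ := fun n => (hf n).toLp with hF
  have hsub : ∀ (h : α → ℝ) (H : MemLp h (ENNReal.ofReal p) μ) n,
      ∫ x, |f n x - h x| ^ p ∂μ = ‖F n - H.toLp‖ ^ p := by
    intro h H n
    rw [← hnorm]
    refine integral_congr_ae ?_
    filter_upwards [Lp.coeFn_sub (F n) H.toLp, (hf n).coeFn_toLp, H.coeFn_toLp] with x h1 h2 h3
    rw [h1, Pi.sub_apply, h2, h3]
  have hcau : CauchySeq F := by
    refine Metric.cauchySeq_iff.2 fun ε hε => ?_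
    obtain ⟨n₀, h⟩ := hc (ε ^ p) (by positivity)
    refine ⟨n₀, fun m hm n hn => ?_⟩
    have := h m hm n hn
    rw [hsub _ (hf n)] at this
    rw [dist_eq_norm]
    exact (Real.rpow_lt_rpow_iff (norm_nonneg _) hε.le hp0).1 this
  obtain ⟨g, hg⟩ := cauchySeq_tendsto_of_complete hcau
  refine ⟨g, Lp.memLp g, ?_, ?_⟩
  · simp only [hsub g (Lp.memLp g), Lp.toLp_coeFn]
    have := ((tendsto_iff_norm_sub_tendsto_zero.1 hg).rpow_const (p := p) (Or.inr hp0.le))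
    rwa [Real.zero_rpow hp0.ne'] at this
  · rw [hnorm]
    refine (hg.norm.rpow_const (Or.inr hp0.le)).congr fun n => ?_
    rw [← hnorm]
    refine integral_congr_ae ?_
    filter_upwards [(hf n).coeFn_toLp] with x h1
    rw [h1]

end Lp

/-! ### Weak derivatives on an interval -/

theorem IsCompact.exists_subset_Icc_of_subset_Ioo {K : Set ℝ} (hK : IsCompact K) {a b : ℝ}
    (hab : a < b) (h : K ⊆ Ioo a b) : ∃ c d, a < c ∧ d < b ∧ K ⊆ Icc c d := by
  rcases K.eq_empty_or_nonempty with rfl | hne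
  · exact ⟨b, a, hab, hab, empty_subset _⟩
  · obtain ⟨c, hc⟩ := hK.exists_isLeast hne
    obtain ⟨d, hd⟩ := hK.exists_isGreatest hne
    exact ⟨c, d, (h hc.1).1, (h hd.1).2, fun x hx => ⟨hc.2 hx, hd.2 hx⟩⟩

/-- A test function of mean zero is the derivative of a test function. -/
theorem exists_deriv_eq_of_integral_eq_zero {a b : ℝ} (hab : a < b) {h : ℝ → ℝ}
    (hh : ContDiff ℝ ∞ h) (hc : HasCompactSupport h) (hs : tsupport h ⊆ Ioo a b)
    (h0 : ∫ x in a..b, h x = 0) :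
    ∃ φ : ℝ → ℝ, ContDiff ℝ ∞ φ ∧ HasCompactSupport φ ∧ tsupport φ ⊆ Ioo a b ∧ deriv φ = h := by
  obtain ⟨c, d, hac, hdb, hcd⟩ := IsCompact.exists_subset_Icc_of_subset_Ioo hc hab hs
  have hd : ∀ x, HasDerivAt (fun x => ∫ t in a..x, h t) (h x) x := fun x =>
    hh.continuous.integral_hasStrictDerivAt a x |>.hasDerivAt
  have hderiv : deriv (fun x => ∫ t in a..x, h t) = h := funext fun x => (hd x).deriv
  have hz : ∀ x, x ∉ Icc c d → h x = 0 := fun x hx =>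
    image_eq_zero_of_notMem_tsupport fun hx' => hx (hcd hx')
  have hsupp : Function.support (fun x => ∫ t in a..x, h t) ⊆ Icc c d := by
    intro x hx
    by_contra hx'
    refine hx ?_
    -- Left of `c` the primitive vanishes because `h` does; right of `d` it equals the full
    -- integral, which is zero.
    rw [mem_Icc, not_and_or, not_le, not_le] at hx'
    rcases hx' with hx' | hx'
    · refine intervalIntegral.integral_zero_ae (Eventually.of_forall fun t ht => hz t fun ht' => ?_)
      rw [mem_uIoc] at ht
      rcases ht with ht | ht <;> linarith [ht.1, ht.2, ht'.1, ht'.2]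
    · have h1 := intervalIntegral.integral_add_adjacent_intervals
        (hh.continuous.intervalIntegrable (μ := volume) a x) (hh.continuous.intervalIntegrable x b)
      have h2 : ∫ t in x..b, h t = 0 := by
        refine intervalIntegral.integral_zero_ae
          (Eventually.of_forall fun t ht => hz t fun ht' => ?_)
        rw [mem_uIoc] at ht
        rcases ht with ht | ht <;> linarith [ht.1, ht.2, ht'.1, ht'.2]
      simp only
      linarith
  have hts : tsupport (fun x => ∫ t in a..x, h t) ⊆ Icc c d := closure_minimal hsupp isClosed_Icc
  refine ⟨_, contDiff_infty_iff_deriv.2 ⟨fun x => (hd x).differentiableAt, by rwa [hderiv]⟩,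
    HasCompactSupport.of_support_subset_isCompact isCompact_Icc hsupp, ?_, hderiv⟩
  exact hts.trans fun x hx => ⟨hac.trans_le hx.1, hx.2.trans_lt hdb⟩

/-- The du Bois-Reymond lemma. -/
theorem exists_eq_const_of_integral_mul_deriv_eq_zero {a b : ℝ} (hab : a < b) {v : ℝ → ℝ}
    (hv : ContinuousOn v (Icc a b))
    (h : ∀ φ : ℝ → ℝ, ContDiff ℝ ∞ φ → HasCompactSupport φ → tsupport φ ⊆ Ioo a b →
      ∫ x in a..b, v x * deriv φ x = 0) :
    ∀ x ∈ Icc a b, v x = v a := by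
  -- With a bump η of integral 1, ψ - (∫ ψ) η has mean zero for every test function ψ, hence is the
  -- derivative of a test function. So `v` is constant with value ∫ v η.
  obtain ⟨η, hη1, hη2, hη3, hη4⟩ : ∃ η : ℝ → ℝ, ContDiff ℝ ∞ η ∧ HasCompactSupport η ∧
      tsupport η ⊆ Ioo a b ∧ ∫ x in a..b, η x = 1 := by
    let f : ContDiffBump ((a + b) / 2) := ⟨(b - a) / 8, (b - a) / 4, by linarith, by linarith⟩
    have hts : tsupport f ⊆ Ioo a b := by
      rw [f.tsupport_eq, Real.closedBall_eq_Icc]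
      intro x hx
      have h1 : (a + b) / 2 - (b - a) / 4 ≤ x := hx.1
      have h2 : x ≤ (a + b) / 2 + (b - a) / 4 := hx.2
      constructor <;> linarith
    have hts' : Function.support (f.normed volume) ⊆ Ioo a b := by
      rw [f.support_normed_eq, ← f.support_eq]
      exact (subset_tsupport _).trans hts
    refine ⟨f.normed volume, f.contDiff_normed, f.hasCompactSupport_normed, ?_, ?_⟩
    · rw [f.tsupport_normed_eq, ← f.tsupport_eq]; exact hts
    · rw [intervalIntegral.integral_eq_integral_of_support_subset
        (hts'.trans Ioo_subset_Ioc_self), f.integral_normed]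
  have hvi : ∀ ψ : ℝ → ℝ, Continuous ψ → IntervalIntegrable (fun x => v x * ψ x) volume a b :=
    fun ψ hψ => ContinuousOn.intervalIntegrable (by
      rw [uIcc_of_le hab.le]; exact hv.mul hψ.continuousOn)
  set c := ∫ x in a..b, v x * η x with hc
  have key : ∀ ψ : ℝ → ℝ, ContDiff ℝ ∞ ψ → HasCompactSupport ψ → tsupport ψ ⊆ Ioo a b →
      ∫ x, ψ x • (v x - c) = 0 := by
    intro ψ h1 h2 h3
    set I := ∫ x in a..b, ψ x with hI
    obtain ⟨φ, hφ1, hφ2, hφ3, hφ4⟩ := exists_deriv_eq_of_integral_eq_zero hab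
      (h := fun x => ψ x + (-I) * η x)
      (h1.add (contDiff_const.mul hη1)) (h2.add (hη2.mul_left (f := fun _ => -I)))
      ((tsupport_add ψ (fun x => -I * η x)).trans
        (union_subset h3 ((tsupport_mul_subset_right (f := fun _ => -I)).trans hη3)))
      (by
        rw [intervalIntegral.integral_add (h1.continuous.intervalIntegrable _ _)
          ((hη1.continuous.intervalIntegrable _ _).const_mul _),
          intervalIntegral.integral_const_mul, hη4]
        simp [hI])
    have h4 := h φ hφ1 hφ2 hφ3
    have h5 : ∫ x in a..b, v x * deriv φ x = (∫ x in a..b, v x * ψ x) + (-I) * c := by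
      rw [hφ4, hc, ← intervalIntegral.integral_const_mul, ← intervalIntegral.integral_add
        (hvi _ h1.continuous) ((hvi _ hη1.continuous).const_mul _)]
      exact intervalIntegral.integral_congr fun x _ => by ring
    have h6 : ∫ x in a..b, ψ x • (v x - c) = (∫ x in a..b, v x * ψ x) - c * I := by
      rw [hI, ← intervalIntegral.integral_const_mul, ← intervalIntegral.integral_sub
        (hvi _ h1.continuous) ((h1.continuous.intervalIntegrable _ _).const_mul _)]
      exact intervalIntegral.integral_congr fun x _ => by simp only [smul_eq_mul]; ring
    rw [← intervalIntegral.integral_eq_integral_of_support_subset, h6]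
    · linarith
    · intro x hx
      refine Ioo_subset_Ioc_self (h3 (subset_tsupport ψ fun h7 => hx ?_))
      simp only [h7, zero_smul]
  have hae := isOpen_Ioo.ae_eq_zero_of_integral_contDiff_smul_eq_zero
    (((hv.mono Ioo_subset_Icc_self).sub continuousOn_const).locallyIntegrableOn
      measurableSet_Ioo) key
  have hEq : EqOn (fun x => v x - c) (fun _ => 0) (Icc a b) := by
    have h1 : (fun x => v x - c) =ᵐ[volume.restrict (Ioo a b)] fun _ => 0 :=
      (ae_restrict_iff' measurableSet_Ioo).2 hae
    rw [restrict_Ioo_eq_restrict_Icc] at h1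
    exact Measure.eqOn_Icc_of_ae_eq volume hab.ne h1 (hv.sub continuousOn_const) continuousOn_const
  intro x hx
  have h1 := hEq hx
  have h2 := hEq (left_mem_Icc.2 hab.le)
  simp only at h1 h2
  linarith

namespace QuantumGraph

/-- The primitive of `g` is absolutely continuous, so integration by parts shows that `u` minus this
primitive has weak derivative zero; du Bois-Reymond makes the difference constant. -/
theorem HasWeakDerivOn.sub_eq_integral {ℓ : ℝ} (hℓ : 0 < ℓ) {u g : ℝ → ℝ}
    (h : HasWeakDerivOn 0 ℓ u g) (hu : ContinuousOn u (Icc 0 ℓ))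
    (hg : IntervalIntegrable g volume 0 ℓ) {x y : ℝ} (hx : x ∈ Icc 0 ℓ) (hy : y ∈ Icc 0 ℓ) :
    u y - u x = ∫ t in x..y, g t := by
  have hG := hg.absolutelyContinuousOnInterval_intervalIntegral (c := 0) (by simp)
  have hGc := hG.continuousOn
  rw [uIcc_of_le hℓ.le] at hGc
  have key := exists_eq_const_of_integral_mul_deriv_eq_zero hℓ
    (v := fun x => u x - ∫ t in (0 : ℝ)..x, g t) (hu.sub hGc) (by
      intro φ h1 h2 h3
      have hφ0 : φ 0 = 0 := image_eq_zero_of_notMem_tsupport fun h => lt_irrefl _ (h3 h).1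
      have hφℓ : φ ℓ = 0 := image_eq_zero_of_notMem_tsupport fun h => lt_irrefl _ (h3 h).2
      have hd : Continuous (deriv φ) := h1.continuous_deriv (by simp)
      have h4 := hG.integral_mul_deriv_eq_deriv_mul
        ((h1.of_le (by simp)).contDiffOn.absolutelyContinuousOnInterval (f := φ))
      have h5 : ∫ x in (0 : ℝ)..ℓ, deriv (fun x => ∫ t in (0 : ℝ)..x, g t) x * φ x =
          ∫ x in (0 : ℝ)..ℓ, g x * φ x := by
        refine intervalIntegral.integral_congr_ae ?_
        filter_upwards [hg.ae_hasDerivAt_integral] with x hx hx'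
        rw [(hx (uIoc_subset_uIcc hx') 0 (by simp)).deriv]
      have h6 := h φ h1 h2 h3
      simp only [sub_mul]
      rw [intervalIntegral.integral_sub, h4, h5, h6, hφ0, hφℓ]
      · ring
      · exact ContinuousOn.intervalIntegrable (by
          rw [uIcc_of_le hℓ.le]; exact hu.mul hd.continuousOn)
      · exact ContinuousOn.intervalIntegrable (by
          rw [uIcc_of_le hℓ.le]; exact hGc.mul hd.continuousOn))
  have h1 := key x hx
  have h2 := key y hy
  have hI : ∀ z ∈ Icc 0 ℓ, IntervalIntegrable g volume 0 z := fun z hz =>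
    hg.mono_set (by rw [uIcc_of_le hz.1, uIcc_of_le hℓ.le]; exact Icc_subset_Icc_right hz.2)
  rw [← intervalIntegral.integral_interval_sub_left (hI y hy) (hI x hx)]
  linarith

end QuantumGraph

/-! ### Functions on the metric graph: energy, mass and pointwise bounds -/

/-- Hölder's inequality against the constant function `1`. -/
theorem integral_abs_le_rpow_mul_measure {α : Type*} [MeasurableSpace α] {μ : Measure α}
    [IsFiniteMeasure μ] {p : ℝ} (hp : 1 < p) {f : α → ℝ} (hf : MemLp f (ENNReal.ofReal p) μ) :
    ∫ x, |f x| ∂μ ≤ (∫ x, |f x| ^ p ∂μ) ^ (1 / p) * (μ.real univ) ^ (1 - 1 / p) := by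
  have hpq := Real.HolderConjugate.conjExponent hp
  have h := integral_mul_le_Lp_mul_Lq_of_nonneg hpq (μ := μ) (f := fun x => |f x|)
    (g := fun _ => (1 : ℝ)) (ae_of_all _ fun x => abs_nonneg _) (ae_of_all _ fun x => zero_le_one)
    hf.abs (memLp_const 1)
  have h1 : 1 / p.conjExponent = 1 - 1 / p := by
    have := hpq.inv_add_inv_eq_one
    simp only [one_div]; linarith
  rw [h1] at h
  simpa using h

namespace QuantumGraph

variable {V E : Type*} {Γ : DirectedGraph V E} {ℓ : E → ℝ} {p : ℝ}

theorem intervalIntegral_eq_integral_Ioo {a : ℝ} (ha : 0 ≤ a) (f : ℝ → ℝ) :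
    ∫ x in (0 : ℝ)..a, f x = ∫ x in Ioo 0 a, f x := by
  rw [intervalIntegral.integral_of_le ha, integral_Ioc_eq_integral_Ioo]

theorem intervalIntegrable_of_memLp_Ioo (hp : 1 < p) {a : ℝ} (ha : 0 ≤ a) {f : ℝ → ℝ}
    (hf : MemLp f (ENNReal.ofReal p) (volume.restrict (Ioo 0 a))) :
    IntervalIntegrable f volume 0 a := by
  rw [intervalIntegrable_iff_integrableOn_Ioo_of_le ha]
  exact hf.integrable (by simpa using hp.le)

theorem memLp_Ioo_of_continuousOn {a : ℝ} {f : ℝ → ℝ} {q : ENNReal}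
    (hf : ContinuousOn f (Icc 0 a)) : MemLp f q (volume.restrict (Ioo 0 a)) := by
  obtain ⟨C, hC⟩ := isCompact_Icc.exists_bound_of_continuousOn hf
  refine MemLp.of_bound ((hf.mono Ioo_subset_Icc_self).aestronglyMeasurable measurableSet_Ioo) C ?_
  exact (ae_restrict_iff' measurableSet_Ioo).2 (ae_of_all _ fun x hx => hC x ⟨hx.1.le, hx.2.le⟩)

namespace W1p

theorem memLp_toFun (u : W1p Γ ℓ p) (e : E) :
    MemLp (u.toFun e) (ENNReal.ofReal p) (volume.restrict (Ioo 0 (ℓ e))) :=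
  memLp_Ioo_of_continuousOn (u.continuousOn e)

theorem intervalIntegrable_der (hp : 1 < p) (hℓ : ∀ e, 0 < ℓ e) (u : W1p Γ ℓ p) (e : E) :
    IntervalIntegrable (u.der e) volume 0 (ℓ e) :=
  intervalIntegrable_of_memLp_Ioo hp (hℓ e).le (u.memLp_der e)

/-- The linear combination `c u + d v`. -/
def lincomb (hp : 1 < p) (hℓ : ∀ e, 0 < ℓ e) (c d : ℝ) (u v : W1p Γ ℓ p) : W1p Γ ℓ p where
  vertexVal x := c * u.vertexVal x + d * v.vertexVal x
  toFun e x := c * u.toFun e x + d * v.toFun e x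
  der e x := c * u.der e x + d * v.der e x
  continuousOn e := ((u.continuousOn e).const_mul c).add ((v.continuousOn e).const_mul d)
  val_src e := by rw [u.val_src, v.val_src]
  val_tgt e := by rw [u.val_tgt, v.val_tgt]
  memLp_der e := ((u.memLp_der e).const_mul c).add ((v.memLp_der e).const_mul d)
  hasWeakDeriv e := by
    intro φ h1 h2 h3
    have hd : Continuous (deriv φ) := h1.continuous_deriv (by simp)
    have hi : ∀ w : W1p Γ ℓ p, IntervalIntegrable (fun x => w.toFun e x * deriv φ x)
        volume 0 (ℓ e) := fun w => ContinuousOn.intervalIntegrable (by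
      rw [uIcc_of_le (hℓ e).le]; exact (w.continuousOn e).mul hd.continuousOn)
    have hi' : ∀ w : W1p Γ ℓ p, IntervalIntegrable (fun x => w.der e x * φ x)
        volume 0 (ℓ e) := fun w =>
      (w.intervalIntegrable_der hp hℓ e).mul_continuousOn h1.continuous.continuousOn
    simp only [add_mul, mul_assoc]
    rw [intervalIntegral.integral_add ((hi u).const_mul c) ((hi v).const_mul d),
      intervalIntegral.integral_add ((hi' u).const_mul c) ((hi' v).const_mul d)]
    simp only [intervalIntegral.integral_const_mul]
    rw [u.hasWeakDeriv e φ h1 h2 h3, v.hasWeakDeriv e φ h1 h2 h3]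
    ring

theorem lincomb_mem_dirichletSpace (hp : 1 < p) (hℓ : ∀ e, 0 < ℓ e) {VD : Set V}
    {u v : W1p Γ ℓ p} (hu : u ∈ dirichletSpace Γ ℓ p VD) (hv : v ∈ dirichletSpace Γ ℓ p VD)
    (c d : ℝ) : lincomb hp hℓ c d u v ∈ dirichletSpace Γ ℓ p VD := by
  intro x hx
  simp only [lincomb]
  rw [hu x hx, hv x hx]; ring

/-- The function `x (ℓ - x)` on every edge. -/
def parabola (Γ : DirectedGraph V E) (ℓ : E → ℝ) (p : ℝ) : W1p Γ ℓ p where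
  vertexVal _ := 0
  toFun e x := x * (ℓ e - x)
  der e x := ℓ e - 2 * x
  continuousOn e := by fun_prop
  val_src e := by simp
  val_tgt e := by simp
  memLp_der e := memLp_Ioo_of_continuousOn (by fun_prop)
  hasWeakDeriv e := by
    intro φ h1 h2 h3
    have hd : Continuous (deriv φ) := h1.continuous_deriv (by simp)
    rw [intervalIntegral.integral_mul_deriv_eq_deriv_mul (u' := fun x => ℓ e - 2 * x)
      (fun x _ => ?_) (fun x _ => (h1.differentiable (by simp) x).hasDerivAt)
      (Continuous.intervalIntegrable (by fun_prop) _ _) (hd.intervalIntegrable _ _)]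
    · simp
    · have := (hasDerivAt_id x).mul ((hasDerivAt_id x).const_sub (ℓ e))
      convert! this using 1
      simp only [id]; ring

/-- `∫ |u'| ^ p` over one edge. -/
noncomputable def edgeEnergy (u : W1p Γ ℓ p) (e : E) : ℝ := ∫ x in (0 : ℝ)..ℓ e, |u.der e x| ^ p

/-- `∫ |u| ^ p` over one edge. -/
noncomputable def edgeMass (u : W1p Γ ℓ p) (e : E) : ℝ := ∫ x in (0 : ℝ)..ℓ e, |u.toFun e x| ^ p

/-- `∫ |u'| ^ p` over the graph. -/
noncomputable def energy [Fintype E] (u : W1p Γ ℓ p) : ℝ := graphIntegral ℓ fun e x => |u.der e x| ^ p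

/-- `∫ |u| ^ p` over the graph. -/
noncomputable def mass [Fintype E] (u : W1p Γ ℓ p) : ℝ := graphIntegral ℓ fun e x => |u.toFun e x| ^ p

theorem edgeEnergy_nonneg (hℓ : ∀ e, 0 < ℓ e) (u : W1p Γ ℓ p) (e : E) : 0 ≤ u.edgeEnergy e :=
  intervalIntegral.integral_nonneg (hℓ e).le fun x _ => by positivity

theorem edgeMass_nonneg (hℓ : ∀ e, 0 < ℓ e) (u : W1p Γ ℓ p) (e : E) : 0 ≤ u.edgeMass e :=
  intervalIntegral.integral_nonneg (hℓ e).le fun x _ => by positivity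

theorem edgeEnergy_lincomb_zero (hp : 1 < p) (hℓ : ∀ e, 0 < ℓ e) (c : ℝ) (u v : W1p Γ ℓ p)
    (e : E) : (lincomb hp hℓ c 0 u v).edgeEnergy e = |c| ^ p * u.edgeEnergy e := by
  simp only [edgeEnergy, lincomb, zero_mul, add_zero, abs_mul,
    Real.mul_rpow (abs_nonneg _) (abs_nonneg _), intervalIntegral.integral_const_mul]

theorem edgeMass_lincomb_zero (hp : 1 < p) (hℓ : ∀ e, 0 < ℓ e) (c : ℝ) (u v : W1p Γ ℓ p)
    (e : E) : (lincomb hp hℓ c 0 u v).edgeMass e = |c| ^ p * u.edgeMass e := by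
  simp only [edgeMass, lincomb, zero_mul, add_zero, abs_mul,
    Real.mul_rpow (abs_nonneg _) (abs_nonneg _), intervalIntegral.integral_const_mul]

section Fintype

variable [Fintype E]

theorem energy_eq_sum (u : W1p Γ ℓ p) : u.energy = ∑ e, u.edgeEnergy e := rfl

theorem mass_eq_sum (u : W1p Γ ℓ p) : u.mass = ∑ e, u.edgeMass e := rfl

theorem edgeEnergy_le_energy (hℓ : ∀ e, 0 < ℓ e) (u : W1p Γ ℓ p) (e : E) :
    u.edgeEnergy e ≤ u.energy :=
  Finset.single_le_sum (fun e _ => u.edgeEnergy_nonneg hℓ e) (Finset.mem_univ e)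

theorem edgeMass_le_mass (hℓ : ∀ e, 0 < ℓ e) (u : W1p Γ ℓ p) (e : E) : u.edgeMass e ≤ u.mass :=
  Finset.single_le_sum (fun e _ => u.edgeMass_nonneg hℓ e) (Finset.mem_univ e)

theorem energy_nonneg (hℓ : ∀ e, 0 < ℓ e) (u : W1p Γ ℓ p) : 0 ≤ u.energy :=
  Finset.sum_nonneg fun e _ => u.edgeEnergy_nonneg hℓ e

theorem mass_nonneg (hℓ : ∀ e, 0 < ℓ e) (u : W1p Γ ℓ p) : 0 ≤ u.mass :=
  Finset.sum_nonneg fun e _ => u.edgeMass_nonneg hℓ e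

theorem nontrivial_iff_mass_pos (hp : 1 < p) (hℓ : ∀ e, 0 < ℓ e) (u : W1p Γ ℓ p) :
    u.Nontrivial ↔ 0 < u.mass := by
  have hp0 : 0 < p := by linarith
  constructor
  · rintro ⟨e, x, hx, hux⟩
    refine lt_of_lt_of_le ?_ (u.edgeMass_le_mass hℓ e)
    refine intervalIntegral.integral_pos (hℓ e)
      ((u.continuousOn e).abs.rpow_const fun _ _ => Or.inr hp0.le) (fun y _ => by positivity)
      ⟨x, hx, Real.rpow_pos_of_pos (abs_pos.2 hux) p⟩
  · intro h
    by_contra hcon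
    simp only [Nontrivial, not_exists, not_and, not_not] at hcon
    refine h.ne' (Finset.sum_eq_zero fun e _ => ?_)
    rw [intervalIntegral.integral_congr (g := fun _ => (0 : ℝ))]
    · simp
    · intro x hx
      rw [uIcc_of_le (hℓ e).le] at hx
      simp only [hcon e x hx, abs_zero, Real.zero_rpow hp0.ne']

theorem lpNorm_eq_one_iff (hp : 1 < p) (hℓ : ∀ e, 0 < ℓ e) (u : W1p Γ ℓ p) :
    u.lpNorm = 1 ↔ u.mass = 1 := by
  change u.mass ^ (1 / p) = 1 ↔ _
  have h := Real.rpow_left_inj (u.mass_nonneg hℓ) zero_le_one (z := 1 / p) (by positivity)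
  rwa [Real.one_rpow] at h

theorem energy_lincomb_zero (hp : 1 < p) (hℓ : ∀ e, 0 < ℓ e) (c : ℝ) (u v : W1p Γ ℓ p) :
    (lincomb hp hℓ c 0 u v).energy = |c| ^ p * u.energy := by
  simp only [energy_eq_sum, edgeEnergy_lincomb_zero, Finset.mul_sum]

theorem mass_lincomb_zero (hp : 1 < p) (hℓ : ∀ e, 0 < ℓ e) (c : ℝ) (u v : W1p Γ ℓ p) :
    (lincomb hp hℓ c 0 u v).mass = |c| ^ p * u.mass := by
  simp only [mass_eq_sum, edgeMass_lincomb_zero, Finset.mul_sum]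

theorem abs_rpow_mass_neg_inv (hp : 1 < p) {m : ℝ} (hm : 0 < m) : |m ^ (-(1 / p))| ^ p = m⁻¹ := by
  rw [abs_of_pos (Real.rpow_pos_of_pos hm _), ← Real.rpow_mul hm.le,
    show -(1 / p) * p = -1 by field_simp, Real.rpow_neg_one]

end Fintype

/-- The fundamental theorem of calculus combined with Hölder's inequality; it provides the
equicontinuity for Arzelà–Ascoli. -/
theorem abs_sub_le (hp : 1 < p) (hℓ : ∀ e, 0 < ℓ e) (u : W1p Γ ℓ p) (e : E) {x y : ℝ}
    (hx : x ∈ Icc 0 (ℓ e)) (hy : y ∈ Icc 0 (ℓ e)) :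
    |u.toFun e y - u.toFun e x| ≤ u.edgeEnergy e ^ (1 / p) * |y - x| ^ (1 - 1 / p) := by
  wlog hxy : x ≤ y generalizing x y
  · rw [abs_sub_comm, abs_sub_comm y x]
    exact this hy hx (le_of_not_ge hxy)
  have hsub : Ioo x y ⊆ Ioo 0 (ℓ e) := Ioo_subset_Ioo hx.1 hy.2
  have hmem : MemLp (u.der e) (ENNReal.ofReal p) (volume.restrict (Ioo x y)) :=
    (u.memLp_der e).mono_measure (Measure.restrict_mono hsub le_rfl)
  rw [(u.hasWeakDeriv e).sub_eq_integral (hℓ e) (u.continuousOn e)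
    (u.intervalIntegrable_der hp hℓ e) hx hy, intervalIntegral.integral_of_le hxy,
    integral_Ioc_eq_integral_Ioo]
  refine (abs_integral_le_integral_abs).trans
    ((integral_abs_le_rpow_mul_measure hp hmem).trans ?_)
  have h1 : (volume.restrict (Ioo x y)).real univ = |y - x| := by
    rw [measureReal_restrict_apply_univ, Real.volume_real_Ioo_of_le hxy,
      abs_of_nonneg (sub_nonneg.2 hxy)]
  rw [h1]
  gcongr
  rw [edgeEnergy, intervalIntegral_eq_integral_Ioo (hℓ e).le]
  exact setIntegral_mono_set ((u.memLp_der e).integrable_abs_rpow hp)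
    (ae_of_all _ fun x => by positivity) hsub.eventuallyLE

/-- The minimum of |u| on the edge is at most its L^p average, and `abs_sub_le` controls the
distance from it. This gives the uniform bound for Arzelà–Ascoli. -/
theorem abs_le (hp : 1 < p) (hℓ : ∀ e, 0 < ℓ e) (u : W1p Γ ℓ p) (e : E) {x : ℝ}
    (hx : x ∈ Icc 0 (ℓ e)) :
    |u.toFun e x| ≤ (u.edgeMass e / ℓ e) ^ (1 / p) +
      u.edgeEnergy e ^ (1 / p) * (ℓ e) ^ (1 - 1 / p) := by
  have hp0 : 0 < p := by linarith
  obtain ⟨y, hy, hmin⟩ := isCompact_Icc.exists_isMinOn (nonempty_Icc.2 (hℓ e).le)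
    (u.continuousOn e).abs
  have hc : ContinuousOn (fun x => |u.toFun e x| ^ p) (uIcc 0 (ℓ e)) := by
    rw [uIcc_of_le (hℓ e).le]
    exact (u.continuousOn e).abs.rpow_const fun _ _ => Or.inr hp0.le
  have h1 : |u.toFun e y| ^ p * ℓ e ≤ u.edgeMass e := by
    have := intervalIntegral.integral_mono_on (hℓ e).le
      (intervalIntegrable_const (μ := volume) (c := |u.toFun e y| ^ p)) hc.intervalIntegrable
      fun z hz => Real.rpow_le_rpow (abs_nonneg _) (hmin hz) hp0.le
    simpa [mul_comm, edgeMass] using this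
  have h2 : |u.toFun e y| ≤ (u.edgeMass e / ℓ e) ^ (1 / p) := by
    rw [← le_div_iff₀ (hℓ e)] at h1
    have := Real.rpow_le_rpow (by positivity) h1 (z := 1 / p) (by positivity)
    rwa [one_div, Real.rpow_rpow_inv (abs_nonneg _) hp0.ne', ← one_div] at this
  have h3 := u.abs_sub_le hp hℓ e hy hx
  have h4 : |x - y| ^ (1 - 1 / p) ≤ (ℓ e) ^ (1 - 1 / p) := by
    refine Real.rpow_le_rpow (abs_nonneg _) ?_ ?_
    · rw [_root_.abs_le]; constructor <;> linarith [hx.1, hx.2, hy.1, hy.2]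
    · rw [sub_nonneg, div_le_one hp0]; exact hp.le
  have h5 := mul_le_mul_of_nonneg_left h4
    (Real.rpow_nonneg (u.edgeEnergy_nonneg hℓ e) (1 / p))
  have h6 := abs_sub_abs_le_abs_sub (u.toFun e x) (u.toFun e y)
  linarith

end W1p

end QuantumGraph

/-! ### Compactness of minimizing sequences -/

/-- Used with H = |·| ^ p and k = 1 for the masses, and with H = id and k = ψ' for weak derivatives.
The filter is general because midpoints are indexed by pairs. -/
theorem tendsto_integral_comp_mul_of_tendstoUniformlyOn {ι : Type*} {l : Filter ι}
    [l.IsCountablyGenerated] {a : ℝ} (ha : 0 ≤ a) {w : ι → ℝ → ℝ} {f H k : ℝ → ℝ}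
    (hw : ∀ i, ContinuousOn (w i) (Icc 0 a)) (hf : ContinuousOn f (Icc 0 a))
    (h : TendstoUniformlyOn w f l (Icc 0 a)) (hH : Continuous H) (hk : Continuous k) :
    Tendsto (fun i => ∫ x in (0 : ℝ)..a, H (w i x) * k x) l
      (𝓝 (∫ x in (0 : ℝ)..a, H (f x) * k x)) := by
  obtain ⟨B, hB⟩ := isCompact_Icc.exists_bound_of_continuousOn hf
  obtain ⟨M, hM⟩ := (isCompact_Icc (a := -(B + 1)) (b := B + 1)).exists_bound_of_continuousOn
    hH.continuousOn
  have hsub : uIoc (0 : ℝ) a ⊆ Icc 0 a := by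
    rw [uIoc_of_le ha]; exact Ioc_subset_Icc_self
  refine intervalIntegral.tendsto_integral_filter_of_dominated_convergence
    (fun x => M * ‖k x‖) (Eventually.of_forall fun i => ?_) ?_ ?_ ?_
  · exact ((hH.comp_continuousOn ((hw i).mono hsub)).mul hk.continuousOn).aestronglyMeasurable
      measurableSet_uIoc
  · filter_upwards [Metric.tendstoUniformlyOn_iff.1 h 1 one_pos] with i hi
    refine ae_of_all _ fun x hx => ?_
    rw [norm_mul]
    refine mul_le_mul_of_nonneg_right (hM _ ?_) (norm_nonneg _)
    have h1 := hB x (hsub hx)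
    have h2 := hi x (hsub hx)
    rw [Real.dist_eq, abs_lt] at h2
    rw [Real.norm_eq_abs, abs_le] at h1
    constructor <;> linarith
  · exact (hk.norm.const_mul M).intervalIntegrable _ _
  · refine ae_of_all _ fun x hx => ?_
    exact ((hH.tendsto _).comp (h.tendsto_at (hsub hx))).mul_const _

namespace QuantumGraph

variable {V E : Type*} {Γ : DirectedGraph V E} {ℓ : E → ℝ} {p : ℝ} [Fintype E]

namespace W1p

/-- Functions with bounded energy and mass have a uniformly convergent subsequence. -/
theorem exists_subseq_tendstoUniformlyOn (hp : 1 < p) (hℓ : ∀ e, 0 < ℓ e) (u : ℕ → W1p Γ ℓ p)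
    {K M : ℝ} (hK : ∀ n, (u n).energy ≤ K) (hM : ∀ n, (u n).mass ≤ M) :
    ∃ (φ : ℕ → ℕ) (f : E → ℝ → ℝ), StrictMono φ ∧ ∀ e, ContinuousOn (f e) (Icc 0 (ℓ e)) ∧
      TendstoUniformlyOn (fun n => (u (φ n)).toFun e) (f e) atTop (Icc 0 (ℓ e)) := by
  have hp0 : 0 < p := by linarith
  have hq : 0 < 1 - 1 / p := by rw [sub_pos, div_lt_one hp0]; exact hp
  have hK0 : 0 ≤ K := ((u 0).energy_nonneg hℓ).trans (hK 0)
  have hM0 : 0 ≤ M := ((u 0).mass_nonneg hℓ).trans (hM 0)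
  -- Every edge function is extended by a constant to the common interval [0, L], so one application
  -- of Arzelà–Ascoli to vector-valued functions treats all edges at once.
  set L := ∑ e, ℓ e with hL
  have hℓL : ∀ e, ℓ e ≤ L := fun e => Finset.single_le_sum (f := ℓ) (fun e _ => (hℓ e).le)
    (Finset.mem_univ e)
  have hmin : ∀ (x : Icc (0 : ℝ) L) e, min (x : ℝ) (ℓ e) ∈ Icc 0 (ℓ e) := fun x e =>
    ⟨le_min x.2.1 (hℓ e).le, min_le_right _ _⟩
  let F : ℕ → BoundedContinuousFunction (Icc (0 : ℝ) L) (E → ℝ) := fun n =>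
    BoundedContinuousFunction.mkOfCompact ⟨fun x e => (u n).toFun e (min (x : ℝ) (ℓ e)),
      continuous_pi fun e => ((u n).continuousOn e).comp_continuous (by fun_prop)
        fun x => hmin x e⟩
  have hF : ∀ n x e, F n x e = (u n).toFun e (min (x : ℝ) (ℓ e)) := fun n x e => rfl
  set B := ∑ e, ((M / ℓ e) ^ (1 / p) + K ^ (1 / p) * (ℓ e) ^ (1 - 1 / p)) with hB
  have hB0 : ∀ e, 0 ≤ (M / ℓ e) ^ (1 / p) + K ^ (1 / p) * (ℓ e) ^ (1 - 1 / p) := fun e => by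
    have := hℓ e; positivity
  have hcomp : IsCompact (closure (range F)) := by
    refine BoundedContinuousFunction.arzela_ascoli (Metric.closedBall 0 B)
      (isCompact_closedBall _ _) _ ?_ ?_
    · rintro _ x ⟨n, rfl⟩
      rw [mem_closedBall_zero_iff, pi_norm_le_iff_of_nonneg (Finset.sum_nonneg fun e _ => hB0 e)]
      intro e
      rw [hF, Real.norm_eq_abs]
      refine ((u n).abs_le hp hℓ e (hmin x e)).trans (le_trans ?_
        (Finset.single_le_sum (fun e _ => hB0 e) (Finset.mem_univ e)))
      have h1 := ((u n).edgeMass_le_mass hℓ e).trans (hM n)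
      have h2 := ((u n).edgeEnergy_le_energy hℓ e).trans (hK n)
      have h3 := (u n).edgeMass_nonneg hℓ e
      have h4 := (u n).edgeEnergy_nonneg hℓ e
      have h5 := hℓ e
      gcongr
    · refine Metric.equicontinuous_of_continuity_modulus
        (fun t => K ^ (1 / p) * t ^ (1 - 1 / p)) ?_ _ ?_
      · have h1 : ContinuousAt (fun t : ℝ => K ^ (1 / p) * t ^ (1 - 1 / p)) 0 :=
          (Real.continuousAt_rpow_const _ _ (Or.inr hq.le)).const_mul _
        have h2 := h1.tendsto
        rwa [Real.zero_rpow hq.ne', mul_zero] at h2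
      · rintro x y ⟨_, n, rfl⟩
        rw [dist_pi_le_iff (by positivity)]
        intro e
        change dist (F n x e) (F n y e) ≤ _
        rw [hF, hF, dist_comm, Real.dist_eq]
        refine ((u n).abs_sub_le hp hℓ e (hmin x e) (hmin y e)).trans ?_
        have h2 := ((u n).edgeEnergy_le_energy hℓ e).trans (hK n)
        have h4 := (u n).edgeEnergy_nonneg hℓ e
        have h6 : |min (y : ℝ) (ℓ e) - min (x : ℝ) (ℓ e)| ≤ dist x y := by
          rw [dist_comm, Subtype.dist_eq, Real.dist_eq]
          simpa using abs_min_sub_min_le_max (y : ℝ) (ℓ e) (x : ℝ) (ℓ e)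
        gcongr
  obtain ⟨f, -, φ, hφ, hlim⟩ := hcomp.tendsto_subseq fun n => subset_closure (mem_range_self n)
  have hin : ∀ e, ∀ x ∈ Icc 0 (ℓ e), x ∈ Icc 0 L := fun e x hx => ⟨hx.1, hx.2.trans (hℓL e)⟩
  have hL0 : 0 ≤ L := Finset.sum_nonneg fun e _ => (hℓ e).le
  refine ⟨φ, fun e x => f (projIcc 0 L hL0 x) e, hφ, fun e => ⟨?_, ?_⟩⟩
  · exact ((continuous_apply e).comp (f.continuous.comp continuous_projIcc)).continuousOn
  · rw [BoundedContinuousFunction.tendsto_iff_tendstoUniformly, Metric.tendstoUniformly_iff] at hlim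
    refine Metric.tendstoUniformlyOn_iff.2 fun ε hε => ?_
    filter_upwards [hlim ε hε] with n hn x hx
    have h1 := (dist_le_pi_dist _ _ e).trans_lt (hn ⟨x, hin e x hx⟩)
    rw [projIcc_of_mem hL0 (hin e x hx)]
    change dist (f ⟨x, hin e x hx⟩ e) (F (φ n) ⟨x, hin e x hx⟩ e) < ε at h1
    rwa [hF, min_eq_left hx.2] at h1

/-- Hölder's inequality on a bounded interval; it passes the derivative side of the weak identity to
the limit. -/
theorem tendsto_integral_mul_of_tendsto_integral_abs_sub_rpow (hp : 1 < p) {a : ℝ} (ha : 0 ≤ a)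
    {g : ℕ → ℝ → ℝ} {h φ : ℝ → ℝ}
    (hg : ∀ n, MemLp (g n) (ENNReal.ofReal p) (volume.restrict (Ioo 0 a)))
    (hh : MemLp h (ENNReal.ofReal p) (volume.restrict (Ioo 0 a))) (hφ : Continuous φ)
    (hlim : Tendsto (fun n => ∫ x in Ioo 0 a, |g n x - h x| ^ p) atTop (𝓝 0)) :
    Tendsto (fun n => ∫ x in (0 : ℝ)..a, g n x * φ x) atTop (𝓝 (∫ x in (0 : ℝ)..a, h x * φ x)) := by
  have hp0 : 0 < p := by linarith
  obtain ⟨M, hM⟩ := (isCompact_Icc (a := (0 : ℝ)) (b := a)).exists_bound_of_continuousOn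
    hφ.continuousOn
  set c := ((volume.restrict (Ioo 0 a)).real univ) ^ (1 - 1 / p) with hc
  have h1 : Tendsto (fun n => M * ((∫ x in Ioo 0 a, |g n x - h x| ^ p) ^ (1 / p) * c))
      atTop (𝓝 0) := by
    have := ((hlim.rpow_const (p := 1 / p) (Or.inr (by positivity))).mul_const c).const_mul M
    rwa [Real.zero_rpow (by positivity), zero_mul, mul_zero] at this
  rw [tendsto_iff_dist_tendsto_zero]
  refine squeeze_zero (fun _ => dist_nonneg) (fun n => ?_) h1
  have hi : ∀ {k : ℝ → ℝ}, MemLp k (ENNReal.ofReal p) (volume.restrict (Ioo 0 a)) →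
      IntervalIntegrable (fun x => k x * φ x) volume 0 a := fun hk =>
    (intervalIntegrable_of_memLp_Ioo hp ha hk).mul_continuousOn hφ.continuousOn
  rw [Real.dist_eq, ← intervalIntegral.integral_sub (hi (hg n)) (hi hh),
    intervalIntegral_eq_integral_Ioo ha]
  have hsub := (hg n).sub hh
  have hint : Integrable (fun x => |g n x - h x|) (volume.restrict (Ioo 0 a)) :=
    (hsub.integrable (by simpa using hp.le)).abs
  have hM0 : 0 ≤ M := (norm_nonneg _).trans (hM 0 (left_mem_Icc.2 ha))
  calc |∫ x in Ioo 0 a, (g n x * φ x - h x * φ x)|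
      ≤ ∫ x in Ioo 0 a, M * |g n x - h x| := by
        rw [← Real.norm_eq_abs]
        refine norm_integral_le_of_norm_le (hint.const_mul M) ?_
        refine (ae_restrict_iff' measurableSet_Ioo).2 (ae_of_all _ fun x hx => ?_)
        rw [← sub_mul, norm_mul, mul_comm]
        exact mul_le_mul_of_nonneg_right (hM x ⟨hx.1.le, hx.2.le⟩) (norm_nonneg _)
    _ ≤ _ := by
        rw [integral_const_mul]
        exact mul_le_mul_of_nonneg_left (integral_abs_le_rpow_mul_measure hp hsub) hM0

end W1p

/-- Written without a quotient, the Rayleigh bound applies to midpoints and variations that might be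
zero. -/
theorem firstEigenvalue_mul_mass_le (hp : 1 < p) (hℓ : ∀ e, 0 < ℓ e) {VD : Set V} {u : W1p Γ ℓ p}
    (hu : u ∈ dirichletSpace Γ ℓ p VD) : firstEigenvalue Γ ℓ p VD * u.mass ≤ u.energy := by
  rcases (u.mass_nonneg hℓ).eq_or_lt with h | h
  · rw [← h, mul_zero]; exact u.energy_nonneg hℓ
  · rw [← le_div_iff₀ h]
    refine csInf_le ⟨0, ?_⟩ ⟨u, hu, (u.nontrivial_iff_mass_pos hp hℓ).2 h, rfl⟩
    rintro _ ⟨w, -, -, rfl⟩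
    exact div_nonneg (w.energy_nonneg hℓ) (w.mass_nonneg hℓ)

open W1p in
/-- Normalized minimizing sequences of the Rayleigh quotient are relatively compact: on every
edge, the energy and the mass of a subsequence converge to those of a minimizer. -/
theorem exists_minimizer_of_tendsto (hp : 1 < p) (hℓ : ∀ e, 0 < ℓ e) {VD : Set V}
    (u : ℕ → W1p Γ ℓ p) (hu : ∀ n, u n ∈ dirichletSpace Γ ℓ p VD) (hmass : ∀ n, (u n).mass = 1)
    (hlim : Tendsto (fun n => (u n).energy) atTop (𝓝 (firstEigenvalue Γ ℓ p VD))) :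
    ∃ v ∈ dirichletSpace Γ ℓ p VD, v.mass = 1 ∧ v.energy = firstEigenvalue Γ ℓ p VD ∧
      ∃ φ : ℕ → ℕ, StrictMono φ ∧
        ∀ e, Tendsto (fun n => (u (φ n)).edgeEnergy e) atTop (𝓝 (v.edgeEnergy e)) ∧
          Tendsto (fun n => (u (φ n)).edgeMass e) atTop (𝓝 (v.edgeMass e)) := by
  have hp0 : 0 < p := by linarith
  set lam := firstEigenvalue Γ ℓ p VD with hlam
  obtain ⟨K, hK⟩ := hlim.bddAbove_range
  obtain ⟨φ, f, hφ, hf⟩ := exists_subseq_tendstoUniformlyOn hp hℓ u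
    (fun n => hK (mem_range_self n)) (fun n => (hmass n).le)
  set w : ℕ → W1p Γ ℓ p := fun n => u (φ n) with hw
  have hwE : Tendsto (fun n => (w n).energy) atTop (𝓝 lam) := hlim.comp hφ.tendsto_atTop
  have hH : Continuous fun x : ℝ => |x| ^ p :=
    continuous_abs.rpow_const fun _ => Or.inr hp0.le
  have hM : ∀ e, Tendsto (fun n => (w n).edgeMass e) atTop
      (𝓝 (∫ x in (0 : ℝ)..ℓ e, |f e x| ^ p)) := fun e => by
    simpa [edgeMass] using tendsto_integral_comp_mul_of_tendstoUniformlyOn (hℓ e).le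
      (fun n => (w n).continuousOn e) (hf e).1 (hf e).2 hH (continuous_const (y := 1))
  have hMsum : ∑ e, ∫ x in (0 : ℝ)..ℓ e, |f e x| ^ p = 1 := by
    refine tendsto_nhds_unique (tendsto_finsetSum Finset.univ fun e _ => hM e) ?_
    simp only [← mass_eq_sum, hw, hmass]
    exact tendsto_const_nhds
  -- The energy of a midpoint is at least `lam` times its mass, and that mass tends to 1 by uniform
  -- convergence. This bounds the convexity gap of the energies from above.
  let mid : ℕ × ℕ → W1p Γ ℓ p := fun q => lincomb hp hℓ 2⁻¹ 2⁻¹ (w q.1) (w q.2)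
  have hmid : ∀ e, Tendsto (fun q => (mid q).edgeMass e) atTop
      (𝓝 (∫ x in (0 : ℝ)..ℓ e, |f e x| ^ p)) := fun e => by
    have h1 : TendstoUniformlyOn (fun q => (mid q).toFun e) (f e) atTop (Icc 0 (ℓ e)) := by
      refine Metric.tendstoUniformlyOn_iff.2 fun ε hε => ?_
      have h2 := Metric.tendstoUniformlyOn_iff.1 (hf e).2 ε hε
      rw [← prod_atTop_atTop_eq]
      filter_upwards [h2.prod_mk h2] with q hq x hx
      have h3 := hq.1 x hx
      have h4 := hq.2 x hx
      rw [Real.dist_eq, abs_lt] at h3 h4 ⊢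
      change _ < f e x - (2⁻¹ * (w q.1).toFun e x + 2⁻¹ * (w q.2).toFun e x) ∧
        f e x - (2⁻¹ * (w q.1).toFun e x + 2⁻¹ * (w q.2).toFun e x) < _
      constructor <;> linarith
    simpa [edgeMass] using tendsto_integral_comp_mul_of_tendstoUniformlyOn (hℓ e).le
      (fun n => (mid n).continuousOn e) (hf e).1 h1 hH (continuous_const (y := 1))
  have hmidsum : Tendsto (fun q => (mid q).mass) atTop (𝓝 1) := by
    rw [← hMsum]
    exact tendsto_finsetSum Finset.univ fun e _ => hmid e
  have hfst : Tendsto (fun q : ℕ × ℕ => (w q.1).energy) atTop (𝓝 lam) := by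
    rw [← prod_atTop_atTop_eq]; exact hwE.comp tendsto_fst
  have hsnd : Tendsto (fun q : ℕ × ℕ => (w q.2).energy) atTop (𝓝 lam) := by
    rw [← prod_atTop_atTop_eq]; exact hwE.comp tendsto_snd
  have hcau : ∀ e, ∀ η > 0, ∃ n₀, ∀ m ≥ n₀, ∀ n ≥ n₀,
      ∫ x in Ioo 0 (ℓ e), |(w m).der e x - (w n).der e x| ^ p < η := by
    intro e η hη
    have hlam0 : 0 ≤ lam := ge_of_tendsto' hwE fun n => (w n).energy_nonneg hℓ
    -- The bound below tends to 2 * lam * ε, as the `C`-term has limit zero; the summand 1 keeps the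
    -- choice valid when `lam` is 0.
    set ε := η / (2 * (2 * lam + 1)) with hε
    have hε0 : 0 < ε := by positivity
    obtain ⟨C, hC0, hC⟩ := exists_abs_sub_rpow_le hp hε0
    have hbound : ∀ q : ℕ × ℕ, ∫ x in Ioo 0 (ℓ e), |(w q.1).der e x - (w q.2).der e x| ^ p ≤
        ε * ((w q.1).energy + (w q.2).energy) +
          C * (((w q.1).energy + (w q.2).energy) / 2 - lam * (mid q).mass) := by
      intro q
      have hedge : ∀ e, ∫ x in Ioo 0 (ℓ e), |(w q.1).der e x - (w q.2).der e x| ^ p ≤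
          ε * ((w q.1).edgeEnergy e + (w q.2).edgeEnergy e) +
          C * (((w q.1).edgeEnergy e + (w q.2).edgeEnergy e) / 2 - (mid q).edgeEnergy e) := by
        intro e
        have h1 := integral_abs_sub_rpow_le hp hC ((w q.1).memLp_der e) ((w q.2).memLp_der e)
        simp only [edgeEnergy, intervalIntegral_eq_integral_Ioo (hℓ e).le]
        refine h1.trans_eq ?_
        simp only [mid, lincomb, ← mul_add, div_eq_inv_mul]
      have hsum := Finset.sum_le_sum fun e (_ : e ∈ Finset.univ) => hedge e
      have hm := firstEigenvalue_mul_mass_le hp hℓ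
        (lincomb_mem_dirichletSpace hp hℓ (hu (φ q.1)) (hu (φ q.2)) 2⁻¹ 2⁻¹)
      have hm' : lam * (mid q).mass ≤ (mid q).energy := hm
      refine (Finset.single_le_sum (f := fun e => ∫ x in Ioo 0 (ℓ e),
        |(w q.1).der e x - (w q.2).der e x| ^ p)
        (fun e _ => integral_nonneg fun x => by positivity) (Finset.mem_univ e)).trans
          (hsum.trans ?_)
      rw [Finset.sum_add_distrib, ← Finset.mul_sum, ← Finset.mul_sum, Finset.sum_sub_distrib,
        ← Finset.sum_div, Finset.sum_add_distrib]
      simp only [← energy_eq_sum]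
      gcongr
    have hrhs : Tendsto (fun q : ℕ × ℕ => ε * ((w q.1).energy + (w q.2).energy) +
          C * (((w q.1).energy + (w q.2).energy) / 2 - lam * (mid q).mass)) atTop
        (𝓝 (ε * (lam + lam) + C * ((lam + lam) / 2 - lam * 1))) :=
      ((hfst.add hsnd).const_mul ε).add
        ((((hfst.add hsnd).div_const 2).sub (hmidsum.const_mul lam)).const_mul C)
    have hlt : ε * (lam + lam) + C * ((lam + lam) / 2 - lam * 1) < η := by
      have : ε * (2 * (2 * lam + 1)) = η := by rw [hε]; field_simp
      nlinarith
    obtain ⟨n₀, hn₀⟩ := eventually_atTop_prod_self'.1 (hrhs.eventually_lt_const hlt)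
    exact ⟨n₀, fun m hm n hn => (hbound (m, n)).trans_lt (hn₀ m hm n hn)⟩
  have hex : ∀ e, ∃ g, MemLp g (ENNReal.ofReal p) (volume.restrict (Ioo 0 (ℓ e))) ∧
      Tendsto (fun n => ∫ x in Ioo 0 (ℓ e), |(w n).der e x - g x| ^ p) atTop (𝓝 0) ∧
      Tendsto (fun n => ∫ x in Ioo 0 (ℓ e), |(w n).der e x| ^ p) atTop
        (𝓝 (∫ x in Ioo 0 (ℓ e), |g x| ^ p)) := fun e =>
    exists_memLp_tendsto_integral_abs_sub_rpow hp (fun n => (w n).memLp_der e) (hcau e)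
  choose g hg1 hg2 hg3 using hex
  have hpt : ∀ e, ∀ x ∈ Icc 0 (ℓ e), Tendsto (fun n => (w n).toFun e x) atTop (𝓝 (f e x)) :=
    fun e x hx => (hf e).2.tendsto_at hx
  let v : W1p Γ ℓ p :=
    -- The limit exists at end points of edges and on `VD`, the only vertices where the value
    -- matters; elsewhere it may be a default value.
    { vertexVal := fun x => limUnder atTop fun n => (w n).vertexVal x
      toFun := f
      der := g
      continuousOn := fun e => (hf e).1
      val_src := fun e => by
        refine (Tendsto.limUnder_eq ?_).symm
        simpa only [(w _).val_src] using hpt e 0 (left_mem_Icc.2 (hℓ e).le)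
      val_tgt := fun e => by
        refine (Tendsto.limUnder_eq ?_).symm
        simpa only [(w _).val_tgt] using hpt e (ℓ e) (right_mem_Icc.2 (hℓ e).le)
      memLp_der := hg1
      hasWeakDeriv := fun e ψ h1 h2 h3 => by
        have hd : Continuous (deriv ψ) := h1.continuous_deriv (by simp)
        refine tendsto_nhds_unique (tendsto_integral_comp_mul_of_tendstoUniformlyOn (H := id)
          (hℓ e).le (fun n => (w n).continuousOn e) (hf e).1 (hf e).2 continuous_id hd) ?_
        refine (tendsto_integral_mul_of_tendsto_integral_abs_sub_rpow hp (hℓ e).le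
          (fun n => (w n).memLp_der e) (hg1 e) h1.continuous (hg2 e)).neg.congr fun n => ?_
        exact ((w n).hasWeakDeriv e ψ h1 h2 h3).symm }
  have hvE : ∀ e, Tendsto (fun n => (w n).edgeEnergy e) atTop (𝓝 (v.edgeEnergy e)) := fun e => by
    simp only [edgeEnergy, intervalIntegral_eq_integral_Ioo (hℓ e).le]
    exact hg3 e
  refine ⟨v, fun x hx => ?_, hMsum, ?_, φ, hφ, fun e => ⟨hvE e, hM e⟩⟩
  · refine Tendsto.limUnder_eq ?_
    simp only [hw, hu _ x hx]
    exact tendsto_const_nhds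
  · exact tendsto_nhds_unique (tendsto_finsetSum Finset.univ fun e _ => hvE e) hwE

end QuantumGraph

/-! ### Minimizers and the Euler–Lagrange equation -/

theorem abs_rpow_sub_two_mul_abs {p : ℝ} (hp : 1 < p) (x : ℝ) :
    |x| ^ (p - 2) * |x| = |x| ^ (p - 1) := by
  rcases eq_or_ne x 0 with rfl | hx
  · simp [Real.zero_rpow (sub_pos.2 hp).ne']
  · rw [← Real.rpow_add_one (abs_pos.2 hx).ne']
    ring_nf

theorem abs_rpow_sub_two_mul_self {p : ℝ} (hp : 1 < p) (x : ℝ) :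
    |x| ^ (p - 2) * x * x = |x| ^ p := by
  rw [mul_assoc, ← abs_mul_abs_self, ← mul_assoc, abs_rpow_sub_two_mul_abs hp]
  rcases eq_or_ne x 0 with rfl | hx
  · simp [Real.zero_rpow (zero_lt_one.trans hp).ne']
  · rw [← Real.rpow_add_one (abs_pos.2 hx).ne']
    ring_nf

/-- The Gateaux derivative of `f ↦ ∫ |f| ^ p`. -/
theorem hasDerivAt_integral_abs_add_mul_rpow {α : Type*} [MeasurableSpace α] {μ : Measure α}
    {p : ℝ} (hp : 1 < p) {f g : α → ℝ} (hf : MemLp f (ENNReal.ofReal p) μ)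
    (hg : MemLp g (ENNReal.ofReal p) μ) :
    HasDerivAt (fun s : ℝ => ∫ x, |1 * f x + s * g x| ^ p ∂μ)
      (p * ∫ x, |f x| ^ (p - 2) * f x * g x ∂μ) 0 := by
  have hp0 : 0 < p := by linarith
  have hmem : ∀ s : ℝ, MemLp (fun x => 1 * f x + s * g x) (ENNReal.ofReal p) μ := fun s =>
    (hf.const_mul 1).add (hg.const_mul s)
  have hbound : MemLp (fun x => |f x| + |g x|) (ENNReal.ofReal p) μ := hf.abs.add hg.abs
  -- For |s| < 1 the derivative is dominated by p (|f| + |g|) ^ p. The factor `1 *` matches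
  -- `lincomb` with coefficients 1 and s.
  have key := hasDerivAt_integral_of_dominated_loc_of_deriv_le (μ := μ) (x₀ := (0 : ℝ))
    (F := fun s x => |1 * f x + s * g x| ^ p)
    (F' := fun s x => p * |1 * f x + s * g x| ^ (p - 2) * (1 * f x + s * g x) * g x)
    (bound := fun x => p * |(|f x| + |g x|)| ^ p)
    (Metric.ball_mem_nhds 0 one_pos)
    (Eventually.of_forall fun s => ((hmem s).integrable_abs_rpow hp).aestronglyMeasurable)
    ((hmem 0).integrable_abs_rpow hp) ?_ ?_ ((hbound.integrable_abs_rpow hp).const_mul p) ?_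
  · have h := key.2
    rw [← integral_const_mul]
    simpa [mul_assoc] using h
  · have h1 := (hmem 0).aestronglyMeasurable.aemeasurable
    exact ((((h1.abs.pow_const _).const_mul p).mul h1).mul
      hg.aestronglyMeasurable.aemeasurable).aestronglyMeasurable
  · refine ae_of_all _ fun x s hs => ?_
    rw [mem_ball_zero_iff, Real.norm_eq_abs] at hs
    rw [norm_mul, norm_mul, norm_mul, Real.norm_of_nonneg hp0.le,
      Real.norm_of_nonneg (Real.rpow_nonneg (abs_nonneg _) _), Real.norm_eq_abs, Real.norm_eq_abs,
      mul_assoc p, abs_rpow_sub_two_mul_abs hp, mul_assoc]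
    have h2 : |1 * f x + s * g x| ≤ |f x| + |g x| := by
      refine (abs_add_le _ _).trans ?_
      rw [one_mul, abs_mul]
      nlinarith [abs_nonneg (g x), abs_nonneg s]
    have h3 : 0 ≤ |f x| + |g x| := by positivity
    have h4 : (|f x| + |g x|) ^ (p - 1) * (|f x| + |g x|) = |(|f x| + |g x|)| ^ p := by
      rw [abs_of_nonneg h3]
      rcases h3.eq_or_lt with h | h
      · rw [← h, mul_zero, Real.zero_rpow hp0.ne']
      · rw [← Real.rpow_add_one h.ne']; ring_nf
    rw [← h4]
    have h5 : 0 ≤ p - 1 := by linarith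
    have h6 : |g x| ≤ |f x| + |g x| := by linarith [abs_nonneg (f x)]
    gcongr
  · refine ae_of_all _ fun x s _ => ?_
    have h1 : HasDerivAt (fun s : ℝ => 1 * f x + s * g x) (g x) s := by
      simpa using ((hasDerivAt_id s).mul_const (g x)).const_add (1 * f x)
    exact (hasDerivAt_abs_rpow _ hp).comp s h1

namespace QuantumGraph

variable {V E : Type*} {Γ : DirectedGraph V E} {ℓ : E → ℝ} {p : ℝ} [Fintype E]

open W1p

/-- Along u + s w, the energy minus λ times the mass is nonnegative and vanishes at s = 0, so its
derivative there is zero; that is the weak equation. -/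
theorem isEigenfunction_of_energy_eq (hp : 1 < p) (hℓ : ∀ e, 0 < ℓ e) {VD : Set V}
    {u : W1p Γ ℓ p} (hu : u ∈ dirichletSpace Γ ℓ p VD) (hmass : u.mass = 1)
    (hE : u.energy = firstEigenvalue Γ ℓ p VD) :
    IsEigenfunction Γ ℓ p VD (firstEigenvalue Γ ℓ p VD) u := by
  refine ⟨hu, (u.nontrivial_iff_mass_pos hp hℓ).2 (by rw [hmass]; exact one_pos), fun w hw => ?_⟩
  set lam := firstEigenvalue Γ ℓ p VD with hlam
  have hd1 : HasDerivAt (fun s => (lincomb hp hℓ 1 s u w).energy)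
      (p * graphIntegral ℓ fun e x => |u.der e x| ^ (p - 2) * u.der e x * w.der e x) 0 := by
    simp only [energy_eq_sum, edgeEnergy, graphIntegral, Finset.mul_sum]
    refine HasDerivAt.fun_sum fun e _ => ?_
    simp only [intervalIntegral_eq_integral_Ioo (hℓ e).le]
    exact hasDerivAt_integral_abs_add_mul_rpow hp (u.memLp_der e) (w.memLp_der e)
  have hd2 : HasDerivAt (fun s => (lincomb hp hℓ 1 s u w).mass)
      (p * graphIntegral ℓ fun e x => |u.toFun e x| ^ (p - 2) * u.toFun e x * w.toFun e x) 0 := by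
    simp only [mass_eq_sum, edgeMass, graphIntegral, Finset.mul_sum]
    refine HasDerivAt.fun_sum fun e _ => ?_
    simp only [intervalIntegral_eq_integral_Ioo (hℓ e).le]
    exact hasDerivAt_integral_abs_add_mul_rpow hp (u.memLp_toFun e) (w.memLp_toFun e)
  have hmin : IsLocalMin (fun s => (lincomb hp hℓ 1 s u w).energy -
      lam * (lincomb hp hℓ 1 s u w).mass) 0 := by
    refine Eventually.of_forall fun s => ?_
    have h1 := firstEigenvalue_mul_mass_le hp hℓ (lincomb_mem_dirichletSpace hp hℓ hu hw 1 s)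
    beta_reduce
    rw [energy_lincomb_zero, mass_lincomb_zero, hE, hmass]
    simp only [abs_one, Real.one_rpow]
    linarith
  have h0 := hmin.hasDerivAt_eq_zero (hd1.sub (hd2.const_mul lam))
  refine mul_left_cancel₀ (zero_lt_one.trans hp).ne' ?_
  linarith

/-- Testing the weak equation with `u` itself gives energy = λ · mass; the converse is the
Euler–Lagrange equation. -/
theorem mem_normalizedFirstEigenfunctions_iff (hp : 1 < p) (hℓ : ∀ e, 0 < ℓ e) {VD : Set V}
    {u : W1p Γ ℓ p} : u ∈ normalizedFirstEigenfunctions Γ ℓ p VD ↔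
      (u ∈ dirichletSpace Γ ℓ p VD ∧ u.mass = 1) ∧ u.energy = firstEigenvalue Γ ℓ p VD := by
  constructor
  · rintro ⟨⟨h1, -, h2⟩, h3⟩
    have h4 := (u.lpNorm_eq_one_iff hp hℓ).1 h3
    refine ⟨⟨h1, h4⟩, ?_⟩
    have h5 := h2 u h1
    simp only [abs_rpow_sub_two_mul_self hp] at h5
    change u.energy = _ * u.mass at h5
    rwa [h4, mul_one] at h5
  · rintro ⟨⟨h1, h2⟩, h3⟩
    exact ⟨isEigenfunction_of_energy_eq hp hℓ h1 h2 h3, (u.lpNorm_eq_one_iff hp hℓ).2 h2⟩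

end QuantumGraph

/-! ### Changing edge lengths -/

theorem MeasureTheory.MemLp.comp_mul_left_Ioo {a c : ℝ} (hc : 0 < c) {f : ℝ → ℝ} {q : ENNReal}
    (hf : MemLp f q (volume.restrict (Ioo 0 (c * a)))) :
    MemLp (fun x => f (c * x)) q (volume.restrict (Ioo 0 a)) := by
  have he : MeasurableEmbedding fun x : ℝ => c * x :=
    (Homeomorph.mulLeft₀ c hc.ne').measurableEmbedding
  have hpre : (fun x : ℝ => c * x) ⁻¹' Ioo 0 (c * a) = Ioo 0 a := by
    ext x
    exact ⟨fun h => ⟨(mul_pos_iff_of_pos_left hc).1 h.1, lt_of_mul_lt_mul_left h.2 hc.le⟩,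
      fun h => ⟨mul_pos hc h.1, mul_lt_mul_of_pos_left h.2 hc⟩⟩
  have hmap : Measure.map (fun x : ℝ => c * x) (volume.restrict (Ioo 0 a)) =
      ENNReal.ofReal |c⁻¹| • volume.restrict (Ioo 0 (c * a)) := by
    rw [← hpre, ← he.restrict_map, Real.map_volume_mul_left hc.ne', Measure.restrict_smul]
  refine (he.memLp_map_measure_iff (g := f)).1 ?_
  rw [hmap]
  exact hf.smul_measure ENNReal.ofReal_ne_top

namespace QuantumGraph

/-- A test function φ on (0, a) is transported to φ(y / c) on (0, c a), and both integrals are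
changed by x ↦ c x. -/
theorem HasWeakDerivOn.comp_mul_left {a c : ℝ} (hc : 0 < c) {u g : ℝ → ℝ}
    (h : HasWeakDerivOn 0 (c * a) u g) :
    HasWeakDerivOn 0 a (fun x => u (c * x)) (fun x => c * g (c * x)) := by
  intro φ h1 h2 h3
  set ψ : ℝ → ℝ := fun y => φ (c⁻¹ * y) with hψ
  have hts : tsupport ψ = (fun y => c⁻¹ * y) ⁻¹' tsupport φ :=
    tsupport_comp_eq_preimage φ (Homeomorph.mulLeft₀ c⁻¹ (inv_pos.2 hc).ne')
  have key := h ψ (h1.comp (contDiff_const.mul contDiff_id))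
    (h2.comp_homeomorph (Homeomorph.mulLeft₀ c⁻¹ (inv_pos.2 hc).ne')) (by
      rw [hts]
      intro y hy
      have : c⁻¹ * y ∈ Ioo 0 a := h3 hy
      rw [mem_Ioo, inv_mul_eq_div, div_pos_iff_of_pos_right hc, div_lt_iff₀ hc] at this
      exact ⟨this.1, by linarith [this.2]⟩)
  have hd : ∀ x, deriv ψ (c * x) = c⁻¹ * deriv φ x := by
    intro x
    have h4 : HasDerivAt ψ (deriv φ (c⁻¹ * (c * x)) * (c⁻¹ * 1)) (c * x) :=
      ((h1.differentiable (by simp) _).hasDerivAt).comp (c * x)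
        ((hasDerivAt_id (c * x)).const_mul c⁻¹)
    rw [h4.deriv, inv_mul_cancel_left₀ hc.ne']
    ring
  have e1 := intervalIntegral.integral_comp_mul_left (a := 0) (b := a)
    (fun y => u y * deriv ψ y) hc.ne'
  have e2 := intervalIntegral.integral_comp_mul_left (a := 0) (b := a)
    (fun y => g y * ψ y) hc.ne'
  rw [mul_zero] at e1 e2
  have e3 : ∫ x in (0 : ℝ)..a, u (c * x) * deriv φ x =
      c * ∫ x in (0 : ℝ)..a, u (c * x) * deriv ψ (c * x) := by
    rw [← intervalIntegral.integral_const_mul]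
    refine intervalIntegral.integral_congr fun x _ => ?_
    simp only [hd]
    field_simp
  have e4 : ∫ x in (0 : ℝ)..a, c * g (c * x) * φ x =
      c * ∫ x in (0 : ℝ)..a, g (c * x) * ψ (c * x) := by
    rw [← intervalIntegral.integral_const_mul]
    refine intervalIntegral.integral_congr fun x _ => ?_
    simp only [hψ, inv_mul_cancel_left₀ hc.ne', mul_assoc]
  rw [e3, e4, e1, e2, key]
  simp

variable {V E : Type*} {Γ : DirectedGraph V E} {ℓ ℓ' : E → ℝ} {p : ℝ}

namespace W1p

/-- The function obtained by affinely changing the length of every edge from `ℓ e` to `ℓ' e`. -/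
noncomputable def rescale (hℓ : ∀ e, 0 < ℓ e) (hℓ' : ∀ e, 0 < ℓ' e) (u : W1p Γ ℓ p) : W1p Γ ℓ' p where
  vertexVal := u.vertexVal
  toFun e x := u.toFun e (ℓ e / ℓ' e * x)
  der e x := ℓ e / ℓ' e * u.der e (ℓ e / ℓ' e * x)
  continuousOn e := by
    refine (u.continuousOn e).comp (by fun_prop) fun x hx => ?_
    have h1 := hℓ e
    have h2 := hℓ' e
    have h3 := hx.1
    refine ⟨by positivity, ?_⟩
    rw [div_mul_eq_mul_div, div_le_iff₀ h2]
    exact mul_le_mul_of_nonneg_left hx.2 h1.le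
  val_src e := by rw [mul_zero, u.val_src]
  val_tgt e := by rw [div_mul_cancel₀ _ (hℓ' e).ne', u.val_tgt]
  memLp_der e := by
    refine MemLp.const_mul (MemLp.comp_mul_left_Ioo (div_pos (hℓ e) (hℓ' e)) ?_) _
    rw [div_mul_cancel₀ _ (hℓ' e).ne']
    exact u.memLp_der e
  hasWeakDeriv e := by
    refine HasWeakDerivOn.comp_mul_left (div_pos (hℓ e) (hℓ' e)) ?_
    rw [div_mul_cancel₀ _ (hℓ' e).ne']
    exact u.hasWeakDeriv e

theorem edgeMass_rescale (hℓ : ∀ e, 0 < ℓ e) (hℓ' : ∀ e, 0 < ℓ' e) (u : W1p Γ ℓ p) (e : E) :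
    (u.rescale hℓ hℓ').edgeMass e = ℓ' e / ℓ e * u.edgeMass e := by
  have h := intervalIntegral.integral_comp_mul_left (a := 0) (b := ℓ' e)
    (fun y => |u.toFun e y| ^ p) (div_pos (hℓ e) (hℓ' e)).ne'
  rw [mul_zero, div_mul_cancel₀ _ (hℓ' e).ne', inv_div, smul_eq_mul] at h
  exact h

/-- With c = ℓ / ℓ', the chain rule gives c ^ p and the change of variables c⁻¹. This exponent is
the source of the factor p - 1 in the shape functional. -/
theorem edgeEnergy_rescale (hℓ : ∀ e, 0 < ℓ e) (hℓ' : ∀ e, 0 < ℓ' e) (u : W1p Γ ℓ p) (e : E) :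
    (u.rescale hℓ hℓ').edgeEnergy e = (ℓ' e / ℓ e) ^ (1 - p) * u.edgeEnergy e := by
  have hc : 0 < ℓ e / ℓ' e := div_pos (hℓ e) (hℓ' e)
  have h := intervalIntegral.integral_comp_mul_left (a := 0) (b := ℓ' e)
    (fun y => |u.der e y| ^ p) hc.ne'
  rw [mul_zero, div_mul_cancel₀ _ (hℓ' e).ne', smul_eq_mul] at h
  simp only [edgeEnergy, rescale, abs_mul, Real.mul_rpow (abs_nonneg _) (abs_nonneg _),
    intervalIntegral.integral_const_mul]
  rw [h, abs_of_pos hc, ← mul_assoc, ← div_eq_mul_inv, ← Real.rpow_sub_one hc.ne',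
    ← inv_div (ℓ e) (ℓ' e), Real.inv_rpow hc.le, ← Real.rpow_neg hc.le, neg_sub]

theorem edgeMass_rescale_rescale (hℓ : ∀ e, 0 < ℓ e) (hℓ' : ∀ e, 0 < ℓ' e) (u : W1p Γ ℓ p)
    (e : E) : ((u.rescale hℓ hℓ').rescale hℓ' hℓ).edgeMass e = u.edgeMass e := by
  have h1 := (hℓ e).ne'
  have h2 := (hℓ' e).ne'
  rw [edgeMass_rescale, edgeMass_rescale]
  field_simp

theorem edgeEnergy_rescale_rescale (hℓ : ∀ e, 0 < ℓ e) (hℓ' : ∀ e, 0 < ℓ' e) (u : W1p Γ ℓ p)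
    (e : E) : ((u.rescale hℓ hℓ').rescale hℓ' hℓ).edgeEnergy e = u.edgeEnergy e := by
  have h1 := hℓ e
  have h2 := hℓ' e
  rw [edgeEnergy_rescale, edgeEnergy_rescale, ← mul_assoc,
    ← Real.mul_rpow (by positivity) (by positivity), div_mul_div_cancel₀ h2.ne', div_self h1.ne',
    Real.one_rpow, one_mul]

end W1p

open W1p

/-- Supplies an admissible function for every `VD`, so the infimum defining the eigenvalue runs over
a nonempty set. -/
theorem parabola_mem_dirichletSpace (VD : Set V) :
    parabola Γ ℓ p ∈ dirichletSpace Γ ℓ p VD := fun _ _ => rfl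

theorem nontrivial_parabola (hℓ : ∀ e, 0 < ℓ e) (e : E) : (parabola Γ ℓ p).Nontrivial := by
  have h := hℓ e
  refine ⟨e, ℓ e / 2, ⟨by positivity, by linarith⟩, ?_⟩
  simp only [parabola]
  have : 0 < ℓ e / 2 * (ℓ e - ℓ e / 2) := mul_pos (by positivity) (by linarith)
  exact this.ne'

theorem perturbedLength_pos [DecidableEq E] (hℓ : ∀ e, 0 < ℓ e) {e₀ : E} {δ : ℝ} (hδ : 0 < ℓ e₀ + δ) (e : E) :
    0 < perturbedLength ℓ e₀ δ e := by
  unfold perturbedLength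
  split_ifs
  exacts [hδ, hℓ e]

variable [Fintype E]

theorem exists_normalized (hp : 1 < p) (hℓ : ∀ e, 0 < ℓ e) {VD : Set V} {u : W1p Γ ℓ p}
    (hu : u ∈ dirichletSpace Γ ℓ p VD) (hm : 0 < u.mass) :
    ∃ v ∈ dirichletSpace Γ ℓ p VD, v.mass = 1 ∧ v.energy = u.energy / u.mass ∧
      ∀ e, v.edgeEnergy e = u.edgeEnergy e / u.mass ∧ v.edgeMass e = u.edgeMass e / u.mass := by
  refine ⟨lincomb hp hℓ (u.mass ^ (-(1 / p))) 0 u u,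
    lincomb_mem_dirichletSpace hp hℓ hu hu _ _, ?_, ?_, fun e => ⟨?_, ?_⟩⟩
  · rw [mass_lincomb_zero, abs_rpow_mass_neg_inv hp hm, inv_mul_cancel₀ hm.ne']
  · rw [energy_lincomb_zero, abs_rpow_mass_neg_inv hp hm, inv_mul_eq_div]
  · rw [edgeEnergy_lincomb_zero, abs_rpow_mass_neg_inv hp hm, inv_mul_eq_div]
  · rw [edgeMass_lincomb_zero, abs_rpow_mass_neg_inv hp hm, inv_mul_eq_div]

/-! ### The perturbed eigenvalue and its one-sided derivatives -/

section Perturbation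

variable [DecidableEq E]

theorem energy_rescale_perturbedLength (hℓ : ∀ e, 0 < ℓ e) {e₀ : E} {δ : ℝ}
    (hδ : 0 < ℓ e₀ + δ) (u : W1p Γ ℓ p) :
    (u.rescale hℓ (perturbedLength_pos hℓ hδ)).energy =
      u.energy + (((ℓ e₀ + δ) / ℓ e₀) ^ (1 - p) - 1) * u.edgeEnergy e₀ := by
  simp only [energy_eq_sum, edgeEnergy_rescale]
  rw [← Finset.add_sum_erase _ _ (Finset.mem_univ e₀),
    ← Finset.add_sum_erase Finset.univ u.edgeEnergy (Finset.mem_univ e₀),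
    Finset.sum_congr rfl (g := u.edgeEnergy) fun e he => ?_]
  · simp only [perturbedLength, if_true]; ring
  · rw [perturbedLength, if_neg (Finset.ne_of_mem_erase he), div_self (hℓ e).ne', Real.one_rpow,
      one_mul]

theorem mass_rescale_perturbedLength (hℓ : ∀ e, 0 < ℓ e) {e₀ : E} {δ : ℝ}
    (hδ : 0 < ℓ e₀ + δ) (u : W1p Γ ℓ p) :
    (u.rescale hℓ (perturbedLength_pos hℓ hδ)).mass =
      u.mass + ((ℓ e₀ + δ) / ℓ e₀ - 1) * u.edgeMass e₀ := by
  simp only [mass_eq_sum, edgeMass_rescale]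
  rw [← Finset.add_sum_erase _ _ (Finset.mem_univ e₀),
    ← Finset.add_sum_erase Finset.univ u.edgeMass (Finset.mem_univ e₀),
    Finset.sum_congr rfl (g := u.edgeMass) fun e he => ?_]
  · simp only [perturbedLength, if_true]; ring
  · rw [perturbedLength, if_neg (Finset.ne_of_mem_erase he), div_self (hℓ e).ne', one_mul]

/-- The perturbed eigenvalue as an infimum over normalized functions on the unperturbed graph. -/
theorem isGLB_perturbedEigenvalue (hp : 1 < p) (hℓ : ∀ e, 0 < ℓ e) (VD : Set V) {e₀ : E} {δ : ℝ}
    (hδ : 0 < ℓ e₀ + δ) :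
    IsGLB (range fun u : {u : W1p Γ ℓ p // u ∈ dirichletSpace Γ ℓ p VD ∧ u.mass = 1} =>
      (u.1.energy + (((ℓ e₀ + δ) / ℓ e₀) ^ (1 - p) - 1) * u.1.edgeEnergy e₀) /
        (1 + ((ℓ e₀ + δ) / ℓ e₀ - 1) * u.1.edgeMass e₀))
      (perturbedEigenvalue Γ ℓ p VD e₀ δ) := by
  have hℓ' := perturbedLength_pos hℓ hδ
  have hset : (range fun u : {u : W1p Γ ℓ p // u ∈ dirichletSpace Γ ℓ p VD ∧ u.mass = 1} =>
      (u.1.energy + (((ℓ e₀ + δ) / ℓ e₀) ^ (1 - p) - 1) * u.1.edgeEnergy e₀) /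
        (1 + ((ℓ e₀ + δ) / ℓ e₀ - 1) * u.1.edgeMass e₀)) =
      {r | ∃ u ∈ dirichletSpace Γ (perturbedLength ℓ e₀ δ) p VD, u.Nontrivial ∧
        r = u.energy / u.mass} := by
    ext r
    constructor
    · rintro ⟨⟨u, hu, hm⟩, rfl⟩
      refine ⟨u.rescale hℓ hℓ', hu, ?_, ?_⟩
      · obtain ⟨e, x, hx, hux⟩ := (u.nontrivial_iff_mass_pos hp hℓ).2 (hm ▸ one_pos)
        refine ⟨e, perturbedLength ℓ e₀ δ e / ℓ e * x, ⟨?_, ?_⟩, ?_⟩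
        · have h1 := hℓ e
          have h2 := hℓ' e
          have h3 := hx.1
          positivity
        · rw [div_mul_eq_mul_div, div_le_iff₀ (hℓ e)]
          exact mul_le_mul_of_nonneg_left hx.2 (hℓ' e).le
        · simp only [rescale]
          rwa [← mul_assoc, div_mul_div_cancel₀ (hℓ' e).ne', div_self (hℓ e).ne', one_mul]
      · have hM := mass_rescale_perturbedLength hℓ hδ u
        rw [hm] at hM
        exact (congrArg₂ (· / ·) (energy_rescale_perturbedLength hℓ hδ u) hM).symm
    -- Conversely, `v` is pulled back to the fixed graph and normalized there; the quotient is
    -- unchanged because numerator and denominator are both divided by the same mass.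
    · rintro ⟨v, hv, hnt, rfl⟩
      have hvm := (v.nontrivial_iff_mass_pos hp hℓ').1 hnt
      have hum : 0 < (v.rescale hℓ' hℓ).mass := by
        refine ((v.rescale hℓ' hℓ).mass_nonneg hℓ).lt_of_ne' fun h => hvm.ne' ?_
        have h1 := (Finset.sum_eq_zero_iff_of_nonneg
          fun e _ => (v.rescale hℓ' hℓ).edgeMass_nonneg hℓ e).1 h
        refine Finset.sum_eq_zero fun e he => ?_
        have h2 := h1 e he
        rw [edgeMass_rescale] at h2
        exact (mul_eq_zero.1 h2).resolve_left (div_pos (hℓ e) (hℓ' e)).ne'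
      obtain ⟨w, hw, hwm, hwE, hwe⟩ :=
        exists_normalized hp hℓ (VD := VD) (u := v.rescale hℓ' hℓ) hv hum
      refine ⟨⟨w, hw, hwm⟩, ?_⟩
      have h1 := energy_rescale_perturbedLength hℓ hδ (v.rescale hℓ' hℓ)
      have h2 := mass_rescale_perturbedLength hℓ hδ (v.rescale hℓ' hℓ)
      have h3 : ((v.rescale hℓ' hℓ).rescale hℓ hℓ').energy = v.energy :=
        Finset.sum_congr rfl fun e _ => edgeEnergy_rescale_rescale hℓ' hℓ v e
      have h4 : ((v.rescale hℓ' hℓ).rescale hℓ hℓ').mass = v.mass :=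
        Finset.sum_congr rfl fun e _ => edgeMass_rescale_rescale hℓ' hℓ v e
      rw [h3] at h1
      rw [h4] at h2
      simp only [hwE, (hwe e₀).1, (hwe e₀).2]
      rw [h1, ← mul_div_assoc, ← add_div, ← mul_div_assoc, one_add_div hum.ne',
        div_div_div_cancel_right₀ hum.ne', ← h2]
  rw [hset]
  refine isGLB_csInf ⟨_, parabola _ _ _, parabola_mem_dirichletSpace VD,
    nontrivial_parabola hℓ' e₀, rfl⟩ ⟨0, ?_⟩
  rintro _ ⟨u, -, -, rfl⟩
  exact div_nonneg (u.energy_nonneg hℓ') (u.mass_nonneg hℓ')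

theorem perturbedEigenvalue_zero (VD : Set V) (e₀ : E) :
    perturbedEigenvalue Γ ℓ p VD e₀ 0 = firstEigenvalue Γ ℓ p VD := by
  have : perturbedLength ℓ e₀ 0 = ℓ := by
    funext e
    unfold perturbedLength
    split_ifs with h
    · rw [h, add_zero]
    · rfl
  rw [perturbedEigenvalue, this]

/-- The one-sided derivatives of the first eigenvalue along `δ = σ θ`, `θ → 0+`. -/
theorem exists_isLeast_tendsto_perturbedEigenvalue (hp : 1 < p) (hℓ : ∀ e, 0 < ℓ e) (VD : Set V)
    (e₀ : E) (σ : ℝ) :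
    ∃ m, IsLeast ((fun u => σ * shapeFunctional Γ ℓ p VD e₀ u) ''
        normalizedFirstEigenfunctions Γ ℓ p VD) m ∧
      Tendsto (fun θ => (perturbedEigenvalue Γ ℓ p VD e₀ (σ * θ) -
        perturbedEigenvalue Γ ℓ p VD e₀ 0) / θ) (𝓝[>] 0) (𝓝 m) := by
  set lam := firstEigenvalue Γ ℓ p VD with hlam
  have hℓ₀ := hℓ e₀
  obtain ⟨v, hv, hvm, -, -⟩ := exists_normalized hp hℓ (parabola_mem_dirichletSpace VD)
    (((parabola Γ ℓ p).nontrivial_iff_mass_pos hp hℓ).1 (nontrivial_parabola hℓ e₀))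
  have : Nonempty {u : W1p Γ ℓ p // u ∈ dirichletSpace Γ ℓ p VD ∧ u.mass = 1} := ⟨⟨v, hv, hvm⟩⟩
  have hslope : ∀ {f : ℝ → ℝ} {f' : ℝ}, HasDerivAt f f' 0 →
      Tendsto (fun θ => (f θ - f 0) / θ) (𝓝[>] 0) (𝓝 f') := by
    intro f f' hf
    have h1 := hf.tendsto_slope_zero_right
    simpa only [zero_add, smul_eq_mul, inv_mul_eq_div] using h1
  -- The rates β' = σ / ℓ e₀ and α' = σ (1 - p) / ℓ e₀ turn the envelope expression α' a - λ β' b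
  -- into σ times the shape functional.
  have hβd : HasDerivAt (fun θ => (ℓ e₀ + σ * θ) / ℓ e₀) (σ / ℓ e₀) 0 := by
    simpa using (((hasDerivAt_id (0 : ℝ)).const_mul σ).const_add (ℓ e₀)).div_const (ℓ e₀)
  have hαd : HasDerivAt (fun θ => ((ℓ e₀ + σ * θ) / ℓ e₀) ^ (1 - p)) (σ * (1 - p) / ℓ e₀) 0 := by
    have h1 := hβd.rpow_const (p := 1 - p) (Or.inl (by
      rw [mul_zero, add_zero, div_self hℓ₀.ne']; exact one_ne_zero))
    convert h1 using 1
    rw [mul_zero, add_zero, div_self hℓ₀.ne', Real.one_rpow]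
    ring
  have hα := hslope hαd
  have hβ := hslope hβd
  rw [mul_zero, add_zero, div_self hℓ₀.ne', Real.one_rpow] at hα
  rw [mul_zero, add_zero, div_self hℓ₀.ne'] at hβ
  have hev : ∀ᶠ θ in 𝓝[>] (0 : ℝ), 0 < ℓ e₀ + σ * θ := by
    have h1 : ContinuousAt (fun θ : ℝ => ℓ e₀ + σ * θ) 0 := by fun_prop
    have h2 : (0 : ℝ) < ℓ e₀ + σ * 0 := by simpa using hℓ₀
    exact (h1.eventually_const_lt h2).filter_mono nhdsWithin_le_nhds
  have hglb : IsGLB (range fun u : {u : W1p Γ ℓ p // u ∈ dirichletSpace Γ ℓ p VD ∧ u.mass = 1} =>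
      u.1.energy) lam := by
    have h1 := isGLB_perturbedEigenvalue (Γ := Γ) hp hℓ VD (e₀ := e₀) (δ := 0) (by simpa using hℓ₀)
    rw [perturbedEigenvalue_zero] at h1
    simpa [div_self hℓ₀.ne'] using h1
  obtain ⟨m, hm, hlim⟩ := tendsto_envelope
    (a := fun u : {u : W1p Γ ℓ p // u ∈ dirichletSpace Γ ℓ p VD ∧ u.mass = 1} =>
      u.1.edgeEnergy e₀) (b := fun u => u.1.edgeMass e₀)
    (fun u => u.1.edgeEnergy_nonneg hℓ e₀) (fun u => u.1.edgeEnergy_le_energy hℓ e₀)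
    (fun u => u.1.edgeMass_nonneg hℓ e₀)
    (fun u => (u.1.edgeMass_le_mass hℓ e₀).trans_eq u.2.2) hglb
    (by
      intro u hu
      obtain ⟨v, hv, hvm, hvE, φ, hφ, hφe⟩ := exists_minimizer_of_tendsto hp hℓ
        (fun n => (u n).1) (fun n => (u n).2.1) (fun n => (u n).2.2) hu
      exact ⟨⟨v, hv, hvm⟩, hvE, φ, hφ, hφe e₀⟩)
    hα hβ (hev.mono fun θ hθ => isGLB_perturbedEigenvalue (Γ := Γ) hp hℓ VD hθ)
  refine ⟨m, ?_, ?_⟩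
  · convert hm using 1
    ext r
    constructor
    · rintro ⟨u, hu, rfl⟩
      obtain ⟨h1, h2⟩ := (mem_normalizedFirstEigenfunctions_iff hp hℓ).1 hu
      refine ⟨⟨u, h1⟩, h2, ?_⟩
      simp only [shapeFunctional, edgeEnergy, edgeMass, ← hlam]
      ring
    · rintro ⟨⟨u, h1⟩, h2, rfl⟩
      refine ⟨u, (mem_normalizedFirstEigenfunctions_iff hp hℓ).2 ⟨h1, h2⟩, ?_⟩
      simp only [shapeFunctional, edgeEnergy, edgeMass, ← hlam]
      ring
  · rwa [perturbedEigenvalue_zero]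

end Perturbation

end QuantumGraph

theorem mainTheorem4 {V E : Type*} [Finite V] [Fintype E] [DecidableEq E]
    (Γ : QuantumGraph.DirectedGraph V E) (hΓ : Γ.Connected)
    (ℓ : E → ℝ) (hℓ : ∀ e, 0 < ℓ e)
    (VD : Set V) (hVD : VD.Nonempty) (p : ℝ) (hp : 1 < p) (e₀ : E) :
    (∃ m : ℝ,
      IsLeast (QuantumGraph.shapeFunctional Γ ℓ p VD e₀ ''
        QuantumGraph.normalizedFirstEigenfunctions Γ ℓ p VD) m ∧
      Tendsto (fun δ : ℝ => (QuantumGraph.perturbedEigenvalue Γ ℓ p VD e₀ δ -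
        QuantumGraph.perturbedEigenvalue Γ ℓ p VD e₀ 0) / δ) (𝓝[>] 0) (𝓝 m)) ∧
    (∃ M : ℝ,
      IsGreatest (QuantumGraph.shapeFunctional Γ ℓ p VD e₀ ''
        QuantumGraph.normalizedFirstEigenfunctions Γ ℓ p VD) M ∧
      Tendsto (fun δ : ℝ => (QuantumGraph.perturbedEigenvalue Γ ℓ p VD e₀ δ -
        QuantumGraph.perturbedEigenvalue Γ ℓ p VD e₀ 0) / δ) (𝓝[<] 0) (𝓝 M)) := by
  constructor
  · simpa only [one_mul] using
      QuantumGraph.exists_isLeast_tendsto_perturbedEigenvalue (Γ := Γ) hp hℓ VD e₀ 1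
  -- With σ = -1 and δ = -θ, the least value of minus the shape functional is minus its greatest
  -- value, and the difference quotient also changes sign.
  · obtain ⟨m, ⟨⟨u, hu, hum⟩, hmin⟩, hlim⟩ :=
      QuantumGraph.exists_isLeast_tendsto_perturbedEigenvalue (Γ := Γ) hp hℓ VD e₀ (-1)
    refine ⟨-m, ⟨⟨u, hu, ?_⟩, ?_⟩, ?_⟩
    · simp only at hum
      linarith
    · rintro _ ⟨w, hw, rfl⟩
      have := hmin ⟨w, hw, rfl⟩
      simp only at this
      linarith
    · have hneg : Tendsto (fun δ : ℝ => -δ) (𝓝[<] 0) (𝓝[>] 0) := by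
        simpa using tendsto_neg_nhdsLT (a := (0 : ℝ))
      refine (hlim.comp hneg).neg.congr fun δ => ?_
      simp only [Function.comp_def, neg_mul, one_mul, neg_neg, div_neg]
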